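/- Let $a,b,c$ be nonnegative integers with $b\ge a+c-1$. On the triangular lattice with unit side (one family of lattice lines being horizontal), let $H(a,b,c)$ be the hexagon with all angles $120^\circ$ whose horizontal sides have length $b$, whose northwestern and southeastern sides have length $a$, and whose southwestern and northeastern sides have length $c$. A lozenge is the union of two unit triangles sharing a side. The staircase of size $n$ at a corner of the hexagon with angle $120^\circ$ consists of rows of $n-1,n-2,\dots,1$ lozenges with sides parallel to the two sides meeting at the corner: if $p$ is the corner and $u,v$ are the unit vectors along the two sides starting at $p$, it consists of the unit rhombi with sides $u,v$ and corner $p+iu+kv$, where $i,k\ge 0$ are integers and $i+k\le n-2$. Let $H_{\mathrm a}(a,b,c)$ be the region obtained from $H(a,b,c)$ by removing the staircase of size $a$ at the top left corner (where sides of lengths $b$ and $a$ meet) and the staircase of size $c$ at the top right corner (where sides of lengths $b$ and $c$ meet). Then the number $L(H_{\mathrm a}(a,b,c))$ of tilings of this region by lozenges is $$L(H_{\mathrm a}(a,b,c))=P_a(b-a,c),$$ where $$P_n(x,y)=\prod_{j=1}^{n}\frac{(j-1)!\,(x+y+2j)!\,(x-y+2j+1)_j\,(x+2y+3j+1)_{n-j}}{(x+n+2j)!\,(y+n-j)!}$$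 and $(\alpha)_k=\alpha(\alpha+1)\cdots(\alpha+k-1)$ for $k\ge 1$, $(\alpha)_0=1$. -/

import Mathlib

/-- The unit triangles of the triangular lattice. The lattice point `(x, y) : ℤ × ℤ` stands for the
point `x • e₁ + y • e₂` of the plane, where `e₁` is the horizontal unit vector and `e₂` is the
unit vector at angle 60° with `e₁`. -/
inductive UnitTriangle where
  | up (x y : ℤ) : UnitTriangle
  | down (x y : ℤ) : UnitTriangle
  deriving DecidableEq

namespace UnitTriangle

/-- The three vertices of a unit triangle: `up x y` has a horizontal bottom side starting
at `(x, y)`; `down x y` is the triangle that shares with it the side opposite `(x, y)`. -/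
def vertices : UnitTriangle → Finset (ℤ × ℤ)
  | up x y => {(x, y), (x + 1, y), (x, y + 1)}
  | down x y => {(x + 1, y), (x, y + 1), (x + 1, y + 1)}

/-- Two unit triangles are adjacent if they have exactly two vertices, i.e. a side, in common. -/
def Adjacent (s t : UnitTriangle) : Prop := (s.vertices ∩ t.vertices).card = 2

end UnitTriangle

/-- A lozenge is the union of two unit triangles that share a side. -/
def IsLozenge (l : Finset UnitTriangle) : Prop :=
  ∃ s t : UnitTriangle, s.Adjacent t ∧ l = {s, t}

/-- A lozenge tiling of a region `R` (a set of unit triangles): a set of lozenges contained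
in `R` such that each unit triangle of `R` is covered exactly once. -/
def IsLozengeTiling (R : Set UnitTriangle) (T : Finset (Finset UnitTriangle)) : Prop :=
  (∀ l ∈ T, IsLozenge l ∧ ∀ t ∈ l, t ∈ R) ∧ ∀ t ∈ R, ∃! l, l ∈ T ∧ t ∈ l

/-- `L(R)`, the number of lozenge tilings of the region `R`. -/
noncomputable def numTilings (R : Set UnitTriangle) : ℕ :=
  Set.ncard {T : Finset (Finset UnitTriangle) | IsLozengeTiling R T}

/-- The hexagon `H(a,b,c)` with all angles 120°, whose two horizontal sides have length `b`, whose
northwestern and southeastern sides have length `a` and whose southwestern and northeastern sides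
have length `c`. Its corners, counterclockwise from the left end of the bottom side, are
`(0, 0)`, `(b, 0)`, `(b, a)`, `(b - c, a + c)`, `(-c, a + c)`, `(-c, c)`. -/
def hexagon (a b c : ℕ) : Set UnitTriangle :=
  {t | ∀ p ∈ t.vertices, 0 ≤ p.2 ∧ p.2 ≤ (a + c : ℤ) ∧ -(c : ℤ) ≤ p.1 ∧ p.1 ≤ (b : ℤ) ∧
    0 ≤ p.1 + p.2 ∧ p.1 + p.2 ≤ (a + b : ℤ)}

/-- The staircase of lozenges at a corner `p` at which sides in the unit directions `u` and `v`
(forming an angle of 120°) meet: it consists of rows of `n - 1, n - 2, …, 1` lozenges. The `i`-th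
lozenge of the `k`-th row (`i, k = 0, 1, 2, …`) is the unit rhombus with sides `u` and `v` and
corner `q = p + i • u + k • v`; it is the union of the two unit triangles all of whose vertices
are corners of the rhombus. -/
def staircase (p u v : ℤ × ℤ) (n : ℕ) : Set UnitTriangle :=
  {t | ∃ i k : ℕ, i + k + 2 ≤ n ∧
    t.vertices ⊆ {p + i • u + k • v, p + i • u + k • v + u, p + i • u + k • v + v,
      p + i • u + k • v + u + v}}

/-- The region `H_a(a,b,c)`: the hexagon `H(a,b,c)` with the maximal staircases removed from its
top left corner (where sides of lengths `b` and `a` meet) and its top right corner (where sides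
of lengths `b` and `c` meet). -/
def hexagonAdj (a b c : ℕ) : Set UnitTriangle :=
  hexagon a b c \
    (staircase (-(c : ℤ), (a + c : ℤ)) (1, 0) (0, -1) a ∪
      staircase ((b : ℤ) - c, (a + c : ℤ)) (-1, 0) (1, -1) c)

/-- The shifted factorial `(α)_k = α (α + 1) ⋯ (α + k - 1)`. -/
noncomputable def shiftedFactorial (α : ℚ) (k : ℕ) : ℚ := (ascPochhammer ℚ k).eval α

open scoped Nat in
/-- The product
`P_n(x,y) = ∏_{j=1}^n (j-1)! (x+y+2j)! (x-y+2j+1)_j (x+2y+3j+1)_{n-j} / ((x+n+2j)! (y+n-j)!)`,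
for integers `x, y` for which the arguments of all the factorials are nonnegative. -/
noncomputable def productP (n : ℕ) (x y : ℤ) : ℚ :=
  ∏ j ∈ Finset.Icc 1 n,
    (((j - 1)! : ℕ) : ℚ) * (((x + y + 2 * j).toNat ! : ℕ) : ℚ) *
      shiftedFactorial ((x : ℚ) - y + 2 * j + 1) j *
      shiftedFactorial ((x : ℚ) + 2 * y + 3 * j + 1) (n - j) /
    ((((x + n + 2 * j).toNat ! : ℕ) : ℚ) * (((y + n - j).toNat ! : ℕ) : ℚ))

/-! Cut the region along the lattice lines `x = const`. The lozenges that do not cross these lines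
form `a` nonintersecting paths with steps `(1, 0)` and `(1, -1)`. They start at the segments `(m -
c, m + c)`, `0 ≤ m < a`, of the left zigzag and end at heights `0, …, a - 1` on the southeastern
side. The right zigzag confines them to one side of the line `x + 2 y = 2 a + b`, and `b ≥ a + c -
1` puts the starts on the correct side, so the reflection principle counts each path by a difference
of two binomials.

That the tilings are counted by the determinant of these path counts is proved by transfer, one
strip at a time, without a sign-reversing involution. Expanding the tilings at a triangle of the
strip matches Pascal's rule in one column of the determinant; forbidden configurations match
determinants with two equal columns or a zero column (`numTilings_strips_process`).

Reversing rows and columns and applying unitriangular column operations turns the determinant into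
one of ballot numbers, `ballotEntry t y i l`. A shift of the row or column index only changes the
parameters `t, y`, so Desnanot–Jacobi condensation gives a recurrence inside the family. The product
formula satisfies the same recurrence and is positive, so induction on the size finishes the proof
(`det_ballotMatrix`). -/

namespace UnitTriangle

/-! ### Adjacency of unit triangles -/

/-- The three unit triangles that share a side with a given one. -/
def neighbors : UnitTriangle → Finset UnitTriangle
  | up x y => {down x y, down x (y - 1), down (x - 1) y}
  | down x y => {up x y, up x (y + 1), up (x + 1) y}

theorem exists_common_vertices {s t : UnitTriangle} (h : s.Adjacent t) :
    ∃ p q : ℤ × ℤ, p ≠ q ∧ (p ∈ s.vertices ∧ p ∈ t.vertices) ∧ q ∈ s.vertices ∧ q ∈ t.vertices := by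
  obtain ⟨p, q, hpq, he⟩ := Finset.card_eq_two.1 h
  refine ⟨p, q, hpq, Finset.mem_inter.1 ?_, Finset.mem_inter.1 ?_⟩ <;> rw [he] <;> simp

theorem Adjacent.symm {s t : UnitTriangle} (h : s.Adjacent t) : t.Adjacent s := by
  unfold Adjacent at *
  rwa [Finset.inter_comm]

theorem adjacent_up_down_iff (x y x' y' : ℤ) : (up x y).Adjacent (down x' y') ↔
    (x' = x ∧ y' = y) ∨ (x' = x ∧ y' = y - 1) ∨ (x' = x - 1 ∧ y' = y) := by
  constructor
  · intro h
    obtain ⟨⟨p1, p2⟩, ⟨q1, q2⟩, hpq, ⟨hp, hp'⟩, hq, hq'⟩ := exists_common_vertices h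
    simp only [vertices, Finset.mem_insert, Finset.mem_singleton, Prod.mk.injEq] at hp hp' hq hq'
    simp only [ne_eq, Prod.mk.injEq] at hpq
    omega
  · unfold Adjacent
    rintro (⟨rfl, rfl⟩ | ⟨rfl, rfl⟩ | ⟨rfl, rfl⟩)
    · have : (up x' y').vertices ∩ (down x' y').vertices = {(x' + 1, y'), (x', y' + 1)} := by
        ext ⟨u, v⟩
        simp only [vertices, Finset.mem_inter, Finset.mem_insert, Finset.mem_singleton,
          Prod.mk.injEq]
        omega
      rw [this, Finset.card_pair (by simp)]
    · have : (up x' y).vertices ∩ (down x' (y - 1)).vertices = {(x', y), (x' + 1, y)} := by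
        ext ⟨u, v⟩
        simp only [vertices, Finset.mem_inter, Finset.mem_insert, Finset.mem_singleton,
          Prod.mk.injEq]
        omega
      rw [this, Finset.card_pair (by simp)]
    · have : (up x y').vertices ∩ (down (x - 1) y').vertices = {(x, y'), (x, y' + 1)} := by
        ext ⟨u, v⟩
        simp only [vertices, Finset.mem_inter, Finset.mem_insert, Finset.mem_singleton,
          Prod.mk.injEq]
        omega
      rw [this, Finset.card_pair (by simp)]

theorem not_adjacent_up_up (x y x' y' : ℤ) (hne : up x y ≠ up x' y') :
    ¬ (up x y).Adjacent (up x' y') := by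
  intro h
  obtain ⟨⟨p1, p2⟩, ⟨q1, q2⟩, hpq, ⟨hp, hp'⟩, hq, hq'⟩ := exists_common_vertices h
  simp only [vertices, Finset.mem_insert, Finset.mem_singleton, Prod.mk.injEq] at hp hp' hq hq'
  simp only [ne_eq, Prod.mk.injEq, up.injEq] at hpq hne
  omega

theorem not_adjacent_down_down (x y x' y' : ℤ) (hne : down x y ≠ down x' y') :
    ¬ (down x y).Adjacent (down x' y') := by
  intro h
  obtain ⟨⟨p1, p2⟩, ⟨q1, q2⟩, hpq, ⟨hp, hp'⟩, hq, hq'⟩ := exists_common_vertices h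
  simp only [vertices, Finset.mem_insert, Finset.mem_singleton, Prod.mk.injEq] at hp hp' hq hq'
  simp only [ne_eq, Prod.mk.injEq, down.injEq] at hpq hne
  omega

theorem not_adjacent_self (s : UnitTriangle) : ¬ s.Adjacent s := by
  unfold Adjacent
  cases s <;> simp [vertices]

theorem adjacent_iff_mem_neighbors (s t : UnitTriangle) : s.Adjacent t ↔ t ∈ s.neighbors := by
  by_cases hst : s = t
  · subst hst
    simp only [not_adjacent_self, false_iff]
    cases s <;> simp [neighbors]
  cases s with
  | up x y =>
    cases t with
    | up x' y' => simp [neighbors, not_adjacent_up_up x y x' y' hst]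
    | down x' y' => simp [neighbors, adjacent_up_down_iff]
  | down x y =>
    cases t with
    | up x' y' =>
      have : (down x y).Adjacent (up x' y') ↔ (up x' y').Adjacent (down x y) :=
        ⟨Adjacent.symm, Adjacent.symm⟩
      simp only [this, neighbors, adjacent_up_down_iff, Finset.mem_insert, Finset.mem_singleton,
        up.injEq]
      omega
    | down x' y' => simp [neighbors, not_adjacent_down_down x y x' y' hst]

end UnitTriangle

open UnitTriangle

/-! ### Lozenge tilings and their expansion at a triangle -/

theorem IsLozenge.eq_pair {l : Finset UnitTriangle} (hl : IsLozenge l) {t : UnitTriangle}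
    (ht : t ∈ l) : ∃ s, t.Adjacent s ∧ l = {t, s} := by
  obtain ⟨u, v, huv, rfl⟩ := hl
  rcases Finset.mem_insert.1 ht with rfl | h
  · exact ⟨v, huv, rfl⟩
  · rw [Finset.mem_singleton] at h
    subst h
    exact ⟨u, huv.symm, Finset.pair_comm _ _⟩

theorem IsLozenge.nonempty {l : Finset UnitTriangle} (hl : IsLozenge l) : l.Nonempty := by
  obtain ⟨u, v, huv, rfl⟩ := hl
  exact ⟨u, by simp⟩

theorem finite_isLozengeTiling {R : Set UnitTriangle} (hR : R.Finite) :
    {T : Finset (Finset UnitTriangle) | IsLozengeTiling R T}.Finite := by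
  refine (Finset.finite_toSet hR.toFinset.powerset.powerset).subset fun T hT => ?_
  simp only [Finset.mem_coe, Finset.mem_powerset]
  intro l hl
  rw [Finset.mem_powerset]
  intro t ht
  exact hR.mem_toFinset.2 ((hT.1 l hl).2 t ht)

theorem numTilings_empty : numTilings ∅ = 1 := by
  have : {T : Finset (Finset UnitTriangle) | IsLozengeTiling ∅ T} = {∅} := by
    ext T
    simp only [Set.mem_ofPred_eq, Set.mem_singleton_iff]
    constructor
    · intro hT
      refine Finset.eq_empty_of_forall_notMem fun l hl => ?_
      obtain ⟨t, ht⟩ := (hT.1 l hl).1.nonempty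
      exact (hT.1 l hl).2 t ht
    · rintro rfl
      simp [IsLozengeTiling]
  rw [numTilings, this, Set.ncard_singleton]

/-- Two lozenges of a tiling that share a unit triangle are equal. -/
theorem IsLozengeTiling.eq_of_mem {R : Set UnitTriangle} {T : Finset (Finset UnitTriangle)}
    (hT : IsLozengeTiling R T) {l l' : Finset UnitTriangle} (hl : l ∈ T) (hl' : l' ∈ T)
    {t : UnitTriangle} (ht : t ∈ l) (ht' : t ∈ l') : l = l' :=
  (hT.2 t ((hT.1 l hl).2 t ht)).unique ⟨hl, ht⟩ ⟨hl', ht'⟩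

/-- Inserting or erasing the lozenge `{t, s}` is a bijection between the two sets of tilings. -/
theorem ncard_tilings_containing {R : Set UnitTriangle} {s t : UnitTriangle} (hst : t.Adjacent s)
    (ht : t ∈ R) (hs : s ∈ R) :
    {T : Finset (Finset UnitTriangle) | IsLozengeTiling R T ∧ {t, s} ∈ T}.ncard =
      numTilings (R \ {t, s}) := by
  symm
  have hnot : ∀ T, IsLozengeTiling (R \ {t, s}) T → ({t, s} : Finset UnitTriangle) ∉ T := by
    intro T hT h
    have := (hT.1 _ h).2 t (by simp)
    simp at this
  rw [numTilings]
  refine Set.ncard_congr (fun T _ => insert {t, s} T) ?_ ?_ ?_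
  · intro T hT
    refine ⟨⟨?_, ?_⟩, Finset.mem_insert_self _ _⟩
    · intro l hl
      rcases Finset.mem_insert.1 hl with rfl | hl
      · refine ⟨⟨t, s, hst, rfl⟩, ?_⟩
        intro u hu
        rcases Finset.mem_insert.1 hu with rfl | hu
        · exact ht
        · rw [Finset.mem_singleton] at hu
          exact hu ▸ hs
      · exact ⟨(hT.1 l hl).1, fun u hu => ((hT.1 l hl).2 u hu).1⟩
    · intro u hu
      by_cases hus : u ∈ ({t, s} : Finset UnitTriangle)
      · refine ⟨{t, s}, ⟨Finset.mem_insert_self _ _, hus⟩, ?_⟩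
        rintro l ⟨hl, hul⟩
        rcases Finset.mem_insert.1 hl with rfl | hl
        · rfl
        · exact absurd hus (by simpa using ((hT.1 l hl).2 u hul).2)
      · obtain ⟨l, ⟨hl, hul⟩, huniq⟩ := hT.2 u ⟨hu, by simpa using hus⟩
        refine ⟨l, ⟨Finset.mem_insert_of_mem hl, hul⟩, ?_⟩
        rintro l' ⟨hl', hul'⟩
        rcases Finset.mem_insert.1 hl' with rfl | hl'
        · exact absurd hul' hus
        · exact huniq l' ⟨hl', hul'⟩
  · intro T T' hT hT' h
    have := congrArg (fun U => Finset.erase U {t, s}) h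
    simpa [Finset.erase_insert (hnot T hT), Finset.erase_insert (hnot T' hT')] using this
  · rintro T ⟨hT, hmem⟩
    refine ⟨T.erase {t, s}, ⟨?_, ?_⟩, Finset.insert_erase hmem⟩
    · intro l hl
      obtain ⟨hne, hl⟩ := Finset.mem_erase.1 hl
      refine ⟨(hT.1 l hl).1, fun u hu => ⟨(hT.1 l hl).2 u hu, fun hus => hne ?_⟩⟩
      exact hT.eq_of_mem hl hmem hu (by simpa using hus)
    · rintro u ⟨hu, hus⟩
      obtain ⟨l, ⟨hl, hul⟩, huniq⟩ := hT.2 u hu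
      refine ⟨l, ⟨Finset.mem_erase.2 ⟨?_, hl⟩, hul⟩, ?_⟩
      · rintro rfl
        exact hus (by simpa using hul)
      · rintro l' ⟨hl', hul'⟩
        exact huniq l' ⟨(Finset.mem_erase.1 hl').2, hul'⟩

open Classical in
/-- Expansion of the number of tilings according to the lozenge that covers a given triangle. -/
theorem numTilings_expand {R : Set UnitTriangle} (hR : R.Finite) {t : UnitTriangle} (ht : t ∈ R) :
    numTilings R = ∑ s ∈ t.neighbors, if s ∈ R then numTilings (R \ {t, s}) else 0 := by
  have hfin := finite_isLozengeTiling hR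
  have key : ∀ s ∈ t.neighbors, (if s ∈ R then numTilings (R \ {t, s}) else 0) =
      (hfin.toFinset.filter fun T => ({t, s} : Finset UnitTriangle) ∈ T).card := by
    intro s hs
    have hadj := (adjacent_iff_mem_neighbors t s).2 hs
    split_ifs with h
    · rw [← ncard_tilings_containing hadj ht h, ← Set.ncard_coe_finset]
      congr 1
      ext T
      simp
    · symm
      rw [Finset.card_eq_zero, Finset.filter_eq_empty_iff]
      intro T hT hmem
      exact h (((hfin.mem_toFinset.1 hT).1 _ hmem).2 s (by simp))
  rw [Finset.sum_congr rfl key, ← Finset.card_biUnion]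
  · rw [numTilings, Set.ncard_eq_toFinset_card _ hfin]
    congr 1
    ext T
    simp only [Finset.mem_biUnion, Finset.mem_filter, hfin.mem_toFinset, Set.mem_ofPred_eq]
    constructor
    · intro hT
      obtain ⟨l, ⟨hl, htl⟩, -⟩ := hT.2 t ht
      obtain ⟨s, hs, rfl⟩ := (hT.1 l hl).1.eq_pair htl
      exact ⟨s, (adjacent_iff_mem_neighbors t s).1 hs, hT, hl⟩
    · rintro ⟨s, -, hT, -⟩
      exact hT
  · intro s hs s' hs' hne
    rw [Function.onFun, Finset.disjoint_left]
    intro T hT hT'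
    simp only [Finset.mem_filter, hfin.mem_toFinset, Set.mem_ofPred_eq] at hT hT'
    have heq := hT.1.eq_of_mem hT.2 hT'.2 (t := t) (by simp) (by simp)
    have hmem : s ∈ ({t, s'} : Finset UnitTriangle) := heq ▸ (by simp)
    rcases Finset.mem_insert.1 hmem with rfl | h
    · exact not_adjacent_self _ ((adjacent_iff_mem_neighbors _ _).2 hs)
    · exact hne (Finset.mem_singleton.1 h)

open Classical in
theorem numTilings_expand_down {R : Set UnitTriangle} (hR : R.Finite) {x y : ℤ}
    (ht : down x y ∈ R) (hout : up (x + 1) y ∉ R) :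
    numTilings R = (if up x y ∈ R then numTilings (R \ {down x y, up x y}) else 0) +
      (if up x (y + 1) ∈ R then numTilings (R \ {down x y, up x (y + 1)}) else 0) := by
  rw [numTilings_expand hR ht, neighbors, Finset.sum_insert (by simp), Finset.sum_insert (by simp),
    Finset.sum_singleton, if_neg hout, add_zero]

open Classical in
theorem numTilings_expand_up {R : Set UnitTriangle} (hR : R.Finite) {x y : ℤ}
    (ht : up x y ∈ R) (h₁ : down x y ∉ R) (h₂ : down x (y - 1) ∉ R) :
    numTilings R =
      if down (x - 1) y ∈ R then numTilings (R \ {up x y, down (x - 1) y}) else 0 := by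
  rw [numTilings_expand hR ht, neighbors, Finset.sum_insert (by simp; omega),
    Finset.sum_insert (by simp), Finset.sum_singleton, if_neg h₁, if_neg h₂, zero_add, zero_add]

/-- Removing lozenges that are forced across a lattice line does not change the number of
tilings. -/
theorem numTilings_remove_forced (x : ℤ) (F : Finset ℤ) {R : Set UnitTriangle} (hR : R.Finite)
    (hF : ∀ y ∈ F, up x y ∈ R ∧ down (x - 1) y ∈ R) (hout : ∀ y, down x y ∉ R) :
    numTilings R = numTilings (R \ {t | ∃ y ∈ F, t = up x y ∨ t = down (x - 1) y}) := by
  induction F using Finset.induction_on generalizing R with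
  | empty => simp
  | insert y F hy ih =>
    have h := hF y (Finset.mem_insert_self _ _)
    rw [numTilings_expand_up hR h.1 (hout _) (hout _), if_pos h.2,
      ih (hR.subset Set.sdiff_subset) ?_ fun z hz => hout z hz.1]
    · congr 1
      ext t
      simp only [Set.mem_sdiff, Set.mem_insert_iff, Set.mem_singleton_iff, Set.mem_ofPred_eq,
        Finset.exists_mem_insert]
      rw [and_assoc, ← not_or]
    · intro z hz
      have hne : z ≠ y := fun e => hy (e ▸ hz)
      have h' := hF z (Finset.mem_insert_of_mem hz)
      simp [h', hne]

/-! ### Binomial coefficients with integer lower index -/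

/-- The binomial coefficient with an integer lower argument, zero outside `0 ≤ k ≤ n`. -/
def intChoose (n : ℕ) (k : ℤ) : ℤ := if 0 ≤ k then (n.choose k.toNat : ℤ) else 0

theorem intChoose_of_neg (n : ℕ) {k : ℤ} (hk : k < 0) : intChoose n k = 0 := by
  rw [intChoose, if_neg (by omega)]

theorem intChoose_natCast (n k : ℕ) : intChoose n (k : ℤ) = n.choose k := by
  simp [intChoose]

theorem intChoose_of_gt {n : ℕ} {k : ℤ} (hk : (n : ℤ) < k) : intChoose n k = 0 := by
  rw [intChoose, if_pos (by omega), Nat.choose_eq_zero_of_lt (by omega), Nat.cast_zero]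

theorem intChoose_zero_left (k : ℤ) : intChoose 0 k = if k = 0 then 1 else 0 := by
  split_ifs with h
  · simp [h, intChoose]
  · rcases lt_or_gt_of_ne h with h | h
    · exact intChoose_of_neg _ h
    · exact intChoose_of_gt (by simpa using h)

theorem intChoose_succ (n : ℕ) (k : ℤ) :
    intChoose (n + 1) k = intChoose n k + intChoose n (k - 1) := by
  rcases lt_trichotomy k 0 with h | h | h
  · simp [intChoose_of_neg _ h, intChoose_of_neg n (show k - 1 < 0 by omega)]
  · subst h
    simp [intChoose]
  · obtain ⟨m, rfl⟩ : ∃ m : ℕ, k = m + 1 := ⟨(k - 1).toNat, by omega⟩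
    rw [add_sub_cancel_right, intChoose_natCast, ← Nat.cast_succ, intChoose_natCast,
      intChoose_natCast, Nat.choose_succ_succ]
    push_cast
    ring

/-! ### The region cut into strips by lattice lines -/

section Strips

variable (a b c : ℕ)

/-- The lattice segment from `(x, y)` to `(x, y + 1)` is the left side of an upward triangle of
the region (or of its extension to the line `x = b`). -/
def IsSegment (x y : ℤ) : Prop :=
  -(c : ℤ) ≤ x ∧ 0 ≤ y ∧ 0 ≤ x + y ∧ y ≤ x + 2 * c ∧ y + 1 ≤ (a + c : ℤ) ∧
    x + 2 * y + 1 ≤ (2 * a + b : ℤ)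

theorem up_mem_left_staircase_iff (x y : ℤ) :
    up x y ∈ staircase (-(c : ℤ), (a + c : ℤ)) (1, 0) (0, -1) a ↔
      -(c : ℤ) ≤ x ∧ y + 1 ≤ (a + c : ℤ) ∧ x + 2 * c < y := by
  simp only [staircase, Set.mem_ofPred_eq, vertices, Finset.insert_subset_iff,
    Finset.singleton_subset_iff, Finset.mem_insert, Finset.mem_singleton, Prod.mk.injEq,
    Prod.smul_mk, Prod.mk_add_mk, nsmul_eq_mul, mul_one, mul_zero, mul_neg]
  constructor
  · rintro ⟨i, k, h, h'⟩
    omega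
  · rintro ⟨h1, h2, h3⟩
    exact ⟨(x + c).toNat, (a + c - y - 1).toNat, by omega, by omega⟩

theorem down_mem_left_staircase_iff (x y : ℤ) :
    down x y ∈ staircase (-(c : ℤ), (a + c : ℤ)) (1, 0) (0, -1) a ↔
      -(c : ℤ) ≤ x ∧ y + 1 ≤ (a + c : ℤ) ∧ x + 2 * c < y := by
  simp only [staircase, Set.mem_ofPred_eq, vertices, Finset.insert_subset_iff,
    Finset.singleton_subset_iff, Finset.mem_insert, Finset.mem_singleton, Prod.mk.injEq,
    Prod.smul_mk, Prod.mk_add_mk, nsmul_eq_mul, mul_one, mul_zero, mul_neg]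
  constructor
  · rintro ⟨i, k, h, h'⟩
    omega
  · rintro ⟨h1, h2, h3⟩
    exact ⟨(x + c).toNat, (a + c - y - 1).toNat, by omega, by omega⟩

theorem up_mem_right_staircase_iff (x y : ℤ) :
    up x y ∈ staircase ((b : ℤ) - c, (a + c : ℤ)) (-1, 0) (1, -1) c ↔
      x + y + 1 ≤ (a + b : ℤ) ∧ y + 1 ≤ (a + c : ℤ) ∧ (2 * a + b : ℤ) ≤ x + 2 * y := by
  simp only [staircase, Set.mem_ofPred_eq, vertices, Finset.insert_subset_iff,
    Finset.singleton_subset_iff, Finset.mem_insert, Finset.mem_singleton, Prod.mk.injEq,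
    Prod.smul_mk, Prod.mk_add_mk, nsmul_eq_mul, mul_one, mul_zero, mul_neg]
  constructor
  · rintro ⟨i, k, h, h'⟩
    omega
  · rintro ⟨h1, h2, h3⟩
    exact ⟨(a + b - x - y - 1).toNat, (a + c - y - 1).toNat, by omega, by omega⟩

theorem down_mem_right_staircase_iff (x y : ℤ) :
    down x y ∈ staircase ((b : ℤ) - c, (a + c : ℤ)) (-1, 0) (1, -1) c ↔
      x + y + 2 ≤ (a + b : ℤ) ∧ y + 1 ≤ (a + c : ℤ) ∧ (2 * a + b : ℤ) ≤ x + 1 + 2 * y := by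
  simp only [staircase, Set.mem_ofPred_eq, vertices, Finset.insert_subset_iff,
    Finset.singleton_subset_iff, Finset.mem_insert, Finset.mem_singleton, Prod.mk.injEq,
    Prod.smul_mk, Prod.mk_add_mk, nsmul_eq_mul, mul_one, mul_zero, mul_neg]
  constructor
  · rintro ⟨i, k, h, h'⟩
    omega
  · rintro ⟨h1, h2, h3⟩
    exact ⟨(a + b - x - y - 2).toNat, (a + c - y - 1).toNat, by omega, by omega⟩

variable {a b c}

theorem up_mem_hexagonAdj_iff (x y : ℤ) :
    up x y ∈ hexagonAdj a b c ↔ x < b ∧ IsSegment a b c x y := by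
  rw [hexagonAdj, Set.mem_sdiff, Set.mem_union, up_mem_left_staircase_iff,
    up_mem_right_staircase_iff]
  simp only [hexagon, Set.mem_ofPred_eq, vertices, Finset.forall_mem_insert,
    Finset.mem_singleton, forall_eq, IsSegment]
  omega

/-- A downward triangle is labelled by the segment on its right, on the line `x + 1`. The strict
bound excludes the top segments `y = x + 1 + 2 c` along the left zigzag: nothing lies to their left,
so paths start there. -/
theorem down_mem_hexagonAdj_iff (x y : ℤ) :
    down x y ∈ hexagonAdj a b c ↔
      x < b ∧ IsSegment a b c (x + 1) y ∧ y < x + 1 + 2 * c ∧ -(c : ℤ) ≤ x := by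
  rw [hexagonAdj, Set.mem_sdiff, Set.mem_union, down_mem_left_staircase_iff,
    down_mem_right_staircase_iff]
  simp only [hexagon, Set.mem_ofPred_eq, vertices, Finset.forall_mem_insert,
    Finset.mem_singleton, forall_eq, IsSegment]
  omega

variable (a b c)

/-- The part of the region in the strips to the left of the lattice line with abscissa `x`,
together with the downward triangles of the strip to the right of this line whose height is
in `S` and the upward ones of this strip whose height is not in `G`. -/
def strips (x : ℤ) (S G : Set ℤ) : Set UnitTriangle := fun t =>
  match t with
  | up x' y => IsSegment a b c x' y ∧ (x' < x ∨ x' = x ∧ y ∉ G)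
  | down x' y => IsSegment a b c (x' + 1) y ∧ y < x' + 1 + 2 * c ∧ (x' < x ∨ x' = x ∧ y ∈ S)

variable {a b c}

theorem up_mem_strips (x : ℤ) (S G : Set ℤ) (x' y : ℤ) : up x' y ∈ strips a b c x S G ↔
    IsSegment a b c x' y ∧ (x' < x ∨ x' = x ∧ y ∉ G) := Iff.rfl

theorem down_mem_strips (x : ℤ) (S G : Set ℤ) (x' y : ℤ) : down x' y ∈ strips a b c x S G ↔
    IsSegment a b c (x' + 1) y ∧ y < x' + 1 + 2 * c ∧ (x' < x ∨ x' = x ∧ y ∈ S) := Iff.rfl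

theorem finite_strips (x : ℤ) (S G : Set ℤ) : (strips a b c x S G).Finite := by
  let B : Finset (ℤ × ℤ) := Finset.Icc (-(c : ℤ) - 1) x ×ˢ Finset.Icc 0 (a + c : ℤ)
  refine (((B.image fun p => up p.1 p.2) ∪ B.image fun p => down p.1 p.2).finite_toSet).subset ?_
  rintro (⟨x', y⟩ | ⟨x', y⟩) h
  · rw [up_mem_strips, IsSegment] at h
    simp only [Finset.coe_union, Finset.coe_image, Set.mem_union, Set.mem_image]
    refine Or.inl ⟨(x', y), ?_, rfl⟩
    simp only [B, Finset.mem_coe, Finset.mem_product, Finset.mem_Icc]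
    omega
  · rw [down_mem_strips, IsSegment] at h
    simp only [Finset.coe_union, Finset.coe_image, Set.mem_union, Set.mem_image]
    refine Or.inr ⟨(x', y), ?_, rfl⟩
    simp only [B, Finset.mem_coe, Finset.mem_product, Finset.mem_Icc]
    omega

theorem strips_eq_empty (S : Set ℤ) : strips a b c (-(c : ℤ) - 1) S ∅ = ∅ := by
  ext (⟨x', y⟩ | ⟨x', y⟩)
  · rw [up_mem_strips, IsSegment]
    simp only [Set.mem_empty_iff_false, not_false_eq_true, and_true, iff_false]
    omega
  · rw [down_mem_strips, IsSegment]
    simp only [Set.mem_empty_iff_false, iff_false]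
    omega

/-- On the line `x = b` every segment has height in `[0, a)`, so this choice of `G` discards all
upward triangles beyond the southeastern side; these heights are the ends of the paths. -/
theorem strips_eq_hexagonAdj :
    strips a b c b ∅ (Set.Ico 0 (a : ℤ)) = hexagonAdj a b c := by
  ext (⟨x', y⟩ | ⟨x', y⟩)
  · rw [up_mem_strips, up_mem_hexagonAdj_iff, IsSegment, Set.mem_Ico]
    omega
  · rw [down_mem_strips, down_mem_hexagonAdj_iff, IsSegment]
    simp only [Set.mem_empty_iff_false, and_false, or_false]
    omega

/-- The lozenges that cross the lattice line with abscissa `x` outside of the heights in `G`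
are forced. -/
theorem numTilings_strips_cross (x : ℤ) (G : Set ℤ)
    (hG : ∀ y, IsSegment a b c x y → y ∉ G → y < x + 2 * c) :
    numTilings (strips a b c x ∅ G) = numTilings (strips a b c (x - 1) G ∅) := by
  classical
  have hout : ∀ y, down x y ∉ strips a b c x ∅ G := by
    intro y h
    rw [down_mem_strips] at h
    simp at h
  rw [numTilings_remove_forced x
    ((Finset.Icc 0 (a + c : ℤ)).filter fun y => IsSegment a b c x y ∧ y ∉ G)
    (finite_strips _ _ _) ?_ hout]
  · congr 1
    ext (⟨x', y⟩ | ⟨x', y⟩)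
    · simp only [Set.mem_sdiff, up_mem_strips, Set.mem_ofPred_eq, Finset.mem_filter,
        Finset.mem_Icc, up.injEq, reduceCtorEq, or_false, Set.mem_empty_iff_false,
        not_false_eq_true, and_true]
      constructor
      · rintro ⟨⟨h, h'⟩, h''⟩
        refine ⟨h, ?_⟩
        by_contra hx
        obtain ⟨rfl, hy⟩ : x' = x ∧ y ∉ G := h'.resolve_left (by omega)
        exact h'' ⟨y, ⟨by unfold IsSegment at h; omega, h, hy⟩, rfl, rfl⟩
      · rintro ⟨h, h'⟩
        refine ⟨⟨h, Or.inl (by omega)⟩, ?_⟩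
        rintro ⟨z, -, rfl, rfl⟩
        omega
    · simp only [Set.mem_sdiff, down_mem_strips, Set.mem_ofPred_eq, Finset.mem_filter,
        Finset.mem_Icc, down.injEq, reduceCtorEq, false_or, Set.mem_empty_iff_false, and_false,
        or_false]
      constructor
      · rintro ⟨⟨h, h', hx⟩, h''⟩
        refine ⟨h, h', ?_⟩
        by_cases hx' : x' = x - 1
        · subst hx'
          rw [sub_add_cancel] at h
          refine Or.inr ⟨rfl, ?_⟩
          by_contra hy
          exact h'' ⟨y, ⟨by unfold IsSegment at h; omega, h, hy⟩, rfl, rfl⟩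
        · exact Or.inl (by omega)
      · rintro ⟨h, h', hx⟩
        refine ⟨⟨h, h', by omega⟩, ?_⟩
        rintro ⟨z, ⟨-, -, hz⟩, rfl, rfl⟩
        rcases hx with hx | hx
        · omega
        · exact hz hx.2
  · intro y hy
    obtain ⟨-, h, hy⟩ := Finset.mem_filter.1 hy
    rw [up_mem_strips, down_mem_strips]
    refine ⟨⟨h, Or.inr ⟨rfl, hy⟩⟩, by rwa [sub_add_cancel], ?_, Or.inl (by omega)⟩
    have := hG y h hy
    omega

/-- The upward triangle at a starting segment has lost its partners within the strip and has none
across the line, so it cannot be covered. -/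
theorem numTilings_strips_eq_zero (x y : ℤ) (G : Set ℤ) (h : IsSegment a b c x y) (hy : y ∉ G)
    (htop : x + 2 * c ≤ y) : numTilings (strips a b c x ∅ G) = 0 := by
  rw [numTilings_expand_up (finite_strips _ _ _) ((up_mem_strips _ _ _ _ _).2
    ⟨h, Or.inr ⟨rfl, hy⟩⟩), if_neg]
  all_goals
    rw [down_mem_strips]
    simp only [Set.mem_empty_iff_false, and_false, or_false]
    omega

open Classical in
/-- Expansion at a downward triangle of the last strip. -/
theorem numTilings_strips_down (x y : ℤ) (S G : Set ℤ) (h : IsSegment a b c (x + 1) y)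
    (htop : y < x + 1 + 2 * c) (hyS : y ∉ S) :
    numTilings (strips a b c x (insert y S) G) =
      (if IsSegment a b c x y ∧ y ∉ G then numTilings (strips a b c x S (insert y G)) else 0) +
      (if IsSegment a b c x (y + 1) ∧ y + 1 ∉ G then
        numTilings (strips a b c x S (insert (y + 1) G)) else 0) := by
  have key : ∀ z, strips a b c x (insert y S) G \ {down x y, up x z} =
      strips a b c x S (insert z G) := by
    intro z
    ext (⟨x', y'⟩ | ⟨x', y'⟩)
    · simp only [Set.mem_sdiff, up_mem_strips, Set.mem_insert_iff, Set.mem_singleton_iff,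
        reduceCtorEq, false_or, up.injEq]
      by_cases hx : x' = x
      · simp only [hx, true_and, lt_irrefl, false_or]
        tauto
      · simp [hx]
    · simp only [Set.mem_sdiff, down_mem_strips, Set.mem_insert_iff, Set.mem_singleton_iff,
        reduceCtorEq, or_false, down.injEq]
      by_cases hx : x' = x
      · simp only [hx, true_and, lt_irrefl, false_or]
        by_cases hy : y' = y
        · simp [hy, hyS]
        · simp [hy]
      · simp [hx]
  rw [numTilings_expand_down (finite_strips _ _ _) ((down_mem_strips _ _ _ _ _).2
    ⟨h, htop, Or.inr ⟨rfl, Set.mem_insert _ _⟩⟩), key, key]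
  · simp only [up_mem_strips, lt_irrefl, true_and, false_or]
  · rw [up_mem_strips]
    omega

end Strips

/-! ### Path counts and the transfer of determinants across strips -/

section Paths

variable (a b c : ℕ)

/-- The number of lattice paths with `t - m` unit steps in the directions `(1, 0)` and `(1, -1)`
from `(m - c, m + c)` to the point with abscissa `t - c` and ordinate `s` that stay on one side
of the line `x + 2 y = 2 a + b`, as given by the reflection principle. -/
def pathCount (t m : ℕ) (s : ℤ) : ℤ :=
  intChoose (t - m) (c + m - s) - intChoose (t - m) (m - 2 * a - b + t + s)

variable {a b c}

/-- Pascal's rule in both binomials: the last step arrives from height `s` or `s + 1`. -/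
theorem pathCount_succ {t m : ℕ} (hm : m ≤ t) (s : ℤ) :
    pathCount a b c (t + 1) m s = pathCount a b c t m s + pathCount a b c t m (s + 1) := by
  unfold pathCount
  rw [Nat.sub_add_comm hm, intChoose_succ, intChoose_succ,
    show (c + m - s - 1 : ℤ) = c + m - (s + 1) by ring,
    show (m - 2 * a - b + (t + 1 : ℕ) + s - 1 : ℤ) = m - 2 * a - b + t + s by push_cast; ring,
    show (m - 2 * a - b + (t + 1 : ℕ) + s : ℤ) = m - 2 * a - b + t + (s + 1) by push_cast; ring]
  ring

/-- The reflected term would contribute only if `s` were at least `2 a + b - 2 m`, which `b ≥ a + c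
- 1` and `m < a` place above the start. -/
theorem pathCount_self (h : (b : ℤ) ≥ (a : ℤ) + (c : ℤ) - 1) {m : ℕ} (hma : m < a) {s : ℤ}
    (hs : s ≤ c + m) : pathCount a b c m m s = if s = c + m then 1 else 0 := by
  unfold pathCount
  rw [Nat.sub_self, intChoose_zero_left, intChoose_zero_left]
  split_ifs <;> omega

theorem pathCount_eq_zero_of_gt {t m : ℕ} (s : ℤ) (hs : t - c + 2 * s ≤ (2 * a + b : ℤ))
    (hs' : c + m < s) : pathCount a b c t m s = 0 := by
  unfold pathCount
  rw [intChoose_of_neg _ (by omega), intChoose_of_neg _ (by omega), sub_zero]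

/-- A predecessor outside the region lies above the start of the path, or on the reflecting line,
where the two binomials agree, or at `x + y < 0`, out of reach of the allowed steps. -/
theorem pathCount_eq_zero (h : (b : ℤ) ≥ (a : ℤ) + (c : ℤ) - 1) {t m : ℕ} (hm : m ≤ t)
    (hma : m < a) {s v : ℤ} (hs : IsSegment a b c (t - c + 1) s)
    (hv : v = s ∨ v = s + 1) (hnot : ¬ IsSegment a b c (t - c) v) : pathCount a b c t m v = 0 := by
  unfold IsSegment at hs hnot
  by_cases h1 : c + m < v
  · exact pathCount_eq_zero_of_gt v (by omega) h1
  unfold pathCount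
  by_cases h2 : (t : ℤ) - c + 2 * v = 2 * a + b
  · rw [show (m - 2 * a - b + t + v : ℤ) = c + m - v by omega, sub_self]
  · rw [intChoose_of_gt (by omega), intChoose_of_neg _ (by omega), sub_zero]

/-- The matrix of path counts where the first `j` columns belong to the next lattice line. -/
def pathMatrix (a b c t r j : ℕ) (g : Fin r → ℤ) : Matrix (Fin r) (Fin r) ℤ :=
  Matrix.of fun m k => if (k : ℕ) < j then pathCount a b c (t + 1) m (g k)
    else pathCount a b c t m (g k)

theorem pathMatrix_succ {t r j : ℕ} (hr : r ≤ t + 1) (hj : j < r) (g : Fin r → ℤ) :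
    pathMatrix a b c t r (j + 1) g = (pathMatrix a b c t r j g).updateCol ⟨j, hj⟩
      ((fun m : Fin r => pathCount a b c t m (g ⟨j, hj⟩)) +
        fun m : Fin r => pathCount a b c t m (g ⟨j, hj⟩ + 1)) := by
  ext m k
  by_cases hk : k = ⟨j, hj⟩
  · subst hk
    simp only [pathMatrix, Matrix.of_apply, Matrix.updateCol_self, Pi.add_apply, Nat.lt_succ_self,
      if_true]
    rw [pathCount_succ (by omega)]
  · have hk' : (k : ℕ) ≠ j := fun e => hk (Fin.ext e)
    rw [Matrix.updateCol_ne hk]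
    simp only [pathMatrix, Matrix.of_apply]
    simp only [show (k : ℕ) < j + 1 ↔ (k : ℕ) < j by omega]

theorem pathMatrix_update {t r j : ℕ} (hj : j < r) (g : Fin r → ℤ) (v : ℤ) :
    pathMatrix a b c t r j (Function.update g ⟨j, hj⟩ v) =
      (pathMatrix a b c t r j g).updateCol ⟨j, hj⟩ fun m => pathCount a b c t m v := by
  ext m k
  by_cases hk : k = ⟨j, hj⟩
  · subst hk
    simp [pathMatrix]
  · rw [Matrix.updateCol_ne hk]
    simp [pathMatrix, Function.update_of_ne hk]

theorem image_update_of_notMem {α β : Type*} [DecidableEq α] (g : α → β) {i : α} (v : β)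
    {A : Set α} (hi : i ∉ A) : Function.update g i v '' A = g '' A :=
  Set.image_congr fun k hk => Function.update_of_ne (fun e : k = i => hi (e ▸ hk)) v g

-- Induction on the number of paths not yet moved back from the right to the left side of the strip.
-- The topmost of these is moved first; by additivity in its column, its two possible steps give two
-- determinants. Paths above it are already on the left line, so it can collide only with those.
open Classical in
theorem numTilings_strips_process (h : (b : ℤ) ≥ (a : ℤ) + (c : ℤ) - 1) {t r : ℕ}
    (hr : r ≤ t + 1) (hra : r ≤ a)
    (hfin : ∀ g : Fin r → ℤ, StrictMono g → (∀ k, IsSegment a b c (t - c) (g k)) →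
      (numTilings (strips a b c (t - c) ∅ (Set.range g)) : ℤ) = (pathMatrix a b c t r 0 g).det)
    (j : ℕ) (hj : j ≤ r) (g : Fin r → ℤ) (hg : StrictMono g)
    (h₁ : ∀ k : Fin r, (k : ℕ) < j →
      IsSegment a b c (t - c + 1) (g k) ∧ g k < t - c + 1 + 2 * c)
    (h₂ : ∀ k : Fin r, j ≤ k → IsSegment a b c (t - c) (g k)) :
    (numTilings (strips a b c (t - c) (g '' {k | (k : ℕ) < j}) (g '' {k | j ≤ (k : ℕ)})) : ℤ) =
      (pathMatrix a b c t r j g).det := by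
  induction j generalizing g with
  | zero => simpa using hfin g hg fun k => h₂ k (Nat.zero_le _)
  | succ j ih =>
    let i : Fin r := ⟨j, hj⟩
    have hS : g '' {k | (k : ℕ) < j + 1} = insert (g i) (g '' {k | (k : ℕ) < j}) := by
      rw [← Set.image_insert_eq]
      congr 1
      ext k
      simp only [Set.mem_ofPred_eq, Set.mem_insert_iff, i, Fin.ext_iff]
      omega
    have hiS : g i ∉ g '' {k | (k : ℕ) < j} := by
      rintro ⟨k, hk, hki⟩
      rw [hg.injective hki] at hk
      simp [i] at hk
    have hseg := h₁ i (Nat.lt_succ_self j)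
    have term : ∀ v, v = g i ∨ v = g i + 1 →
        (((if IsSegment a b c (t - c) v ∧ v ∉ g '' {k | j + 1 ≤ (k : ℕ)} then
          numTilings (strips a b c (t - c) (g '' {k | (k : ℕ) < j})
            (insert v (g '' {k | j + 1 ≤ (k : ℕ)}))) else 0 : ℕ)) : ℤ) =
        ((pathMatrix a b c t r j g).updateCol i fun m => pathCount a b c t m v).det := by
      intro v hv
      by_cases hvs : IsSegment a b c (t - c) v
      · by_cases hvG : v ∈ g '' {k | j + 1 ≤ (k : ℕ)}
        · rw [if_neg (fun e => e.2 hvG), Nat.cast_zero]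
          obtain ⟨k, hk, rfl⟩ := hvG
          rw [Set.mem_ofPred_eq] at hk
          have hki : k ≠ i := by
            rintro rfl
            simp [i] at hk
          symm
          -- Column `k > j` already belongs to the left line, so the collision makes columns `k` and
          -- `i` equal.
          refine Matrix.det_zero_of_column_eq hki fun m => ?_
          rw [Matrix.updateCol_self, Matrix.updateCol_ne hki]
          simp only [pathMatrix, Matrix.of_apply]
          rw [if_neg (by omega)]
        · rw [if_pos ⟨hvs, hvG⟩, ← pathMatrix_update, ← ih (by omega)]
          · rw [image_update_of_notMem g v (by simp)]
            congr 3
            have : {k : Fin r | j ≤ (k : ℕ)} = insert i {k : Fin r | j + 1 ≤ (k : ℕ)} := by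
              ext k
              simp only [Set.mem_ofPred_eq, Set.mem_insert_iff, i, Fin.ext_iff]
              omega
            rw [this, Set.image_insert_eq, image_update_of_notMem g v (by simp),
              Function.update_self]
          · intro k l hkl
            have hne : ∀ l, i < l → v < g l := by
              intro l hl
              have h1 := hg hl
              have h2 : v ≠ g l := fun e => hvG ⟨l, hl, e.symm⟩
              omega
            by_cases hk : k = i
            · subst hk
              rw [Function.update_self, Function.update_of_ne hkl.ne']
              exact hne l hkl
            · rw [Function.update_of_ne hk]
              by_cases hl : l = i
              · subst hl
                rw [Function.update_self]
                have := hg hkl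
                omega
              · rw [Function.update_of_ne hl]
                exact hg hkl
          · intro k hk
            rw [Function.update_of_ne (by rintro rfl; exact lt_irrefl _ hk)]
            exact h₁ k (by omega)
          · intro k hk
            by_cases hki : k = i
            · subst hki
              rwa [Function.update_self]
            · rw [Function.update_of_ne hki]
              refine h₂ k ?_
              have : (k : ℕ) ≠ j := fun e => hki (Fin.ext e)
              omega
      · rw [if_neg (fun e => hvs e.1), Nat.cast_zero]
        symm
        refine Matrix.det_eq_zero_of_column_eq_zero i fun m => ?_
        rw [Matrix.updateCol_self]
        exact pathCount_eq_zero h (by omega) (by omega) hseg.1 hv hvs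
    rw [pathMatrix_succ hr hj, Matrix.det_updateCol_add, ← term _ (Or.inl rfl),
      ← term _ (Or.inr rfl), hS, numTilings_strips_down _ _ _ _ hseg.1 hseg.2 hiS, Nat.cast_add]

/-- The number of tilings to the left of a lattice line is given by a determinant. -/
def LeftCount (a b c t : ℕ) : Prop :=
  ∀ r, r = min t a → ∀ g : Fin r → ℤ, StrictMono g →
    (∀ k, IsSegment a b c (t - c) (g k) ∧ g k < t - c + 2 * c) →
    (numTilings (strips a b c (t - c - 1) (Set.range g) ∅) : ℤ) =
      (Matrix.of fun m k : Fin r => pathCount a b c t m (g k)).det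

/-- The variant of `LeftCount` where the path that starts at the lattice line is included. -/
def CrossCount (a b c t : ℕ) : Prop :=
  ∀ r, r = min (t + 1) a → ∀ g : Fin r → ℤ, StrictMono g →
    (∀ k, IsSegment a b c (t - c) (g k)) →
    (numTilings (strips a b c (t - c) ∅ (Set.range g)) : ℤ) =
      (Matrix.of fun m k : Fin r => pathCount a b c t m (g k)).det

theorem leftCount_zero : LeftCount a b c 0 := by
  intro r hr g _ _
  have : r = 0 := by omega
  subst this
  rw [Matrix.det_fin_zero, Nat.cast_zero, zero_sub, strips_eq_empty, numTilings_empty,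
    Nat.cast_one]

theorem CrossCount.leftCount_succ (h : (b : ℤ) ≥ (a : ℤ) + (c : ℤ) - 1) {t : ℕ}
    (ht : CrossCount a b c t) : LeftCount a b c (t + 1) := by
  intro r hr g hg hseg
  have hx : ((t + 1 : ℕ) : ℤ) - c = t - c + 1 := by push_cast; ring
  rw [hx] at hseg ⊢
  have hS : g '' {k | (k : ℕ) < r} = Set.range g := by
    rw [← Set.image_univ]
    congr 1
    ext k
    simp
  have hG : g '' {k | r ≤ (k : ℕ)} = ∅ := by
    rw [Set.image_eq_empty, Set.eq_empty_iff_forall_notMem]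
    intro k hk
    exact absurd k.2 (not_lt.2 hk)
  have hP := numTilings_strips_process h (t := t) (r := r) (by omega) (by omega)
    (fun g hg hseg => by simpa [pathMatrix] using ht r hr g hg hseg) r le_rfl g hg
    (fun k _ => hseg k) (fun k hk => absurd k.2 (not_lt.2 hk))
  rw [hS, hG] at hP
  rw [add_sub_cancel_right, hP]
  congr 1
  ext m k
  simp [pathMatrix]

/-- If `t < a`, a new path starts on this line, at its top height `c + t`, and adds a row to the
matrix. Tilings exist only if this height is occupied, necessarily by the last path; the new row is
then a unit vector. For `t ≥ a` nothing starts and all crossings are forced. -/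
theorem LeftCount.crossCount (h : (b : ℤ) ≥ (a : ℤ) + (c : ℤ) - 1) {t : ℕ}
    (ht : LeftCount a b c t) : CrossCount a b c t := by
  intro r hr g hg hseg
  by_cases hta : t < a
  · obtain rfl : r = t + 1 := by omega
    have hlast : ∀ k, pathCount a b c t (Fin.last t) (g k) = if g k = c + t then 1 else 0 := by
      intro k
      have := hseg k
      unfold IsSegment at this
      rw [Fin.val_last, pathCount_self h hta (by omega)]
    by_cases htop : (c + t : ℤ) ∈ Set.range g
    · obtain ⟨k, hk⟩ := htop
      have hgl : g (Fin.last t) = c + t := by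
        have h1 := hg.monotone (Fin.le_last k)
        have h2 := hseg (Fin.last t)
        unfold IsSegment at h2
        omega
      have hlt : ∀ k : Fin t, g k.castSucc < c + t := fun k => hgl ▸ hg (Fin.castSucc_lt_last k)
      rw [numTilings_strips_cross]
      · have hreg : strips a b c (t - c - 1) (Set.range g) ∅ =
            strips a b c (t - c - 1) (Set.range (g ∘ Fin.castSucc)) ∅ := by
          ext (⟨x, y⟩ | ⟨x, y⟩)
          · rw [up_mem_strips, up_mem_strips]
          · rw [down_mem_strips, down_mem_strips]
            have : y < x + 1 + 2 * c → x = t - c - 1 →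
                (y ∈ Set.range g ↔ y ∈ Set.range (g ∘ Fin.castSucc)) := by
              intro hy hx
              constructor
              · rintro ⟨k, rfl⟩
                induction k using Fin.lastCases with
                | last => omega
                | cast k => exact ⟨k, rfl⟩
              · rintro ⟨k, rfl⟩
                exact ⟨_, rfl⟩
            tauto
        -- Expansion along the new row leaves the single minor for the older paths.
        rw [hreg, ht t (by omega) (g ∘ Fin.castSucc) (hg.comp Fin.strictMono_castSucc),
          Matrix.det_succ_row _ (Fin.last t), Finset.sum_eq_single (Fin.last t)]
        · rw [Matrix.of_apply, hlast, if_pos hgl, mul_one, ← two_mul, pow_mul, neg_one_sq,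
            one_pow, one_mul, Fin.succAbove_last]
          congr 1
        · intro k _ hk
          rw [Matrix.of_apply, hlast, if_neg, mul_zero, zero_mul]
          intro e
          exact hk (hg.injective (e.trans hgl.symm))
        · simp
        · intro k
          refine ⟨hseg _, ?_⟩
          have := hlt k
          simp only [Function.comp_apply]
          omega
      · intro y hy hy'
        have : y ≠ c + t := fun e => hy' ⟨k, hk.trans e.symm⟩
        unfold IsSegment at hy
        omega
    · rw [numTilings_strips_eq_zero _ (c + t) _ _ htop (by omega), Nat.cast_zero]
      · symm
        refine Matrix.det_eq_zero_of_row_eq_zero (Fin.last t) fun k => ?_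
        rw [Matrix.of_apply, hlast, if_neg fun e => htop ⟨k, e⟩]
      · unfold IsSegment
        omega
  · have hlt : ∀ y, IsSegment a b c (t - c) y → y < t - c + 2 * c := by
      intro y hy
      unfold IsSegment at hy
      omega
    rw [numTilings_strips_cross _ _ fun y hy _ => hlt y hy]
    exact ht r (by omega) g hg fun k => ⟨hseg k, hlt _ (hseg k)⟩

theorem leftCount (h : (b : ℤ) ≥ (a : ℤ) + (c : ℤ) - 1) (t : ℕ) : LeftCount a b c t := by
  induction t with
  | zero => exact leftCount_zero
  | succ t ih => exact (ih.crossCount h).leftCount_succ h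

/-- The line `t = b + c` is `x = b`; all `a` paths have started by then. -/
theorem numTilings_hexagonAdj_eq_det (h : (b : ℤ) ≥ (a : ℤ) + (c : ℤ) - 1) :
    (numTilings (hexagonAdj a b c) : ℤ) =
      (Matrix.of fun m k : Fin a => pathCount a b c (b + c) m (k : ℕ)).det := by
  have hx : ((b + c : ℕ) : ℤ) - c = b := by push_cast; ring
  have hr : Set.range (fun k : Fin a => ((k : ℕ) : ℤ)) = Set.Ico 0 (a : ℤ) := by
    ext y
    simp only [Set.mem_range, Set.mem_Ico]
    constructor
    · rintro ⟨k, rfl⟩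
      have := k.2
      omega
    · intro hy
      exact ⟨⟨y.toNat, by omega⟩, by simp; omega⟩
  have := (leftCount h (b + c)).crossCount h a (by omega) (fun k => ((k : ℕ) : ℤ))
    (fun k l hkl => by simpa using hkl) fun k => by
      have := k.2
      rw [hx, IsSegment]
      omega
  rwa [hx, hr, strips_eq_hexagonAdj] at this

end Paths
-- Column operations to ballot numbers
/-- The coefficient of `z⁻ᵏ - z` in terms of powers: the `l`-fold application of
`u (k - 1) + 2 u k + u (k + 1)` to an odd sequence has value `∑ k, oddCoeff l k * u (k + 1)`
at `1`. -/
def oddCoeff : ℕ → ℕ → ℤ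
  | 0, 0 => 1
  | 0, _ + 1 => 0
  | l + 1, 0 => 2 * oddCoeff l 0 + oddCoeff l 1
  | l + 1, k + 1 => oddCoeff l k + 2 * oddCoeff l (k + 1) + oddCoeff l (k + 2)

theorem oddCoeff_eq_zero {l k : ℕ} (h : l < k) : oddCoeff l k = 0 := by
  induction l generalizing k with
  | zero =>
    cases k with
    | zero => omega
    | succ k => rfl
  | succ l ih =>
    cases k with
    | zero => omega
    | succ k =>
      rw [oddCoeff, ih (by omega), ih (by omega), ih (by omega)]
      ring

theorem oddCoeff_self (l : ℕ) : oddCoeff l l = 1 := by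
  induction l with
  | zero => rfl
  | succ l ih =>
    rw [oddCoeff, ih, oddCoeff_eq_zero (by omega), oddCoeff_eq_zero (by omega)]
    ring

/-- Summation by parts: the second-order operator moves from `u` to the coefficients. The term at
`0` vanishes by `u 0 = 0`, those at the upper end because `oddCoeff l k = 0` for `k > l`. -/
theorem sum_oddCoeff_succ {l n : ℕ} (h : l + 1 < n) (u : ℕ → ℤ) (hu : u 0 = 0) :
    ∑ k ∈ Finset.range n, oddCoeff l k * (u k + 2 * u (k + 1) + u (k + 2)) =
      ∑ k ∈ Finset.range n, oddCoeff (l + 1) k * u (k + 1) := by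
  obtain ⟨m, rfl⟩ : ∃ m, n = m + 1 := ⟨n - 1, by omega⟩
  have h1 : ∑ k ∈ Finset.range (m + 1), oddCoeff l k * u k =
      oddCoeff l 1 * u 1 + ∑ k ∈ Finset.range m, oddCoeff l (k + 2) * u (k + 2) := by
    rw [Finset.sum_range_succ', hu, mul_zero, add_zero, add_comm,
      ← Finset.sum_range_succ' (fun k => oddCoeff l (k + 1) * u (k + 1)), Finset.sum_range_succ,
      oddCoeff_eq_zero (show l < m + 1 by omega), zero_mul, add_zero]
  have h2 : ∑ k ∈ Finset.range (m + 1), oddCoeff l k * u (k + 1) =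
      oddCoeff l 0 * u 1 + ∑ k ∈ Finset.range m, oddCoeff l (k + 1) * u (k + 2) := by
    rw [Finset.sum_range_succ', add_comm]
  have h3 : ∑ k ∈ Finset.range (m + 1), oddCoeff l k * u (k + 2) =
      ∑ k ∈ Finset.range m, oddCoeff l k * u (k + 2) := by
    rw [Finset.sum_range_succ, oddCoeff_eq_zero (show l < m by omega), zero_mul, add_zero]
  calc _ = ∑ k ∈ Finset.range (m + 1), oddCoeff l k * u k +
        2 * ∑ k ∈ Finset.range (m + 1), oddCoeff l k * u (k + 1) +
        ∑ k ∈ Finset.range (m + 1), oddCoeff l k * u (k + 2) := by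
        rw [Finset.mul_sum, ← Finset.sum_add_distrib, ← Finset.sum_add_distrib]
        exact Finset.sum_congr rfl fun k _ => by ring
    _ = (2 * oddCoeff l 0 + oddCoeff l 1) * u 1 + ∑ k ∈ Finset.range m,
        (oddCoeff l k + 2 * oddCoeff l (k + 1) + oddCoeff l (k + 2)) * u (k + 2) := by
        rw [h1, h2, h3]
        simp only [add_mul, Finset.sum_add_distrib, mul_assoc, ← Finset.mul_sum, mul_add]
        ring
    _ = _ := by
        rw [Finset.sum_range_succ', add_comm]
        rfl

/-- Differences of binomial coefficients at opposite distance from `q`. -/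
def oddChoose (N : ℕ) (q k : ℤ) : ℤ := intChoose N (q + k) - intChoose N (q - k)

theorem oddChoose_add_two (N : ℕ) (q k : ℤ) : oddChoose (N + 2) (q + 1) (k + 1) =
    oddChoose N q k + 2 * oddChoose N q (k + 1) + oddChoose N q (k + 2) := by
  unfold oddChoose
  simp only [intChoose_succ]
  ring_nf

/-- Pascal's rule used twice acts on the odd sequence `oddChoose N q` by `u (k - 1) + 2 u k + u (k +
1)`; this is its `l`-fold iterate at `1`. -/
theorem oddChoose_one_eq_sum {l n : ℕ} (h : l < n) (N : ℕ) (q : ℤ) :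
    oddChoose (N + 2 * l) (q + l) 1 =
      ∑ k ∈ Finset.range n, oddCoeff l k * oddChoose N q ((k : ℤ) + 1) := by
  induction l generalizing N q with
  | zero =>
    rw [Finset.sum_eq_single 0]
    · simp [oddCoeff]
    · intro k _ hk
      rw [oddCoeff_eq_zero (by omega), zero_mul]
    · intro h0
      exact absurd (Finset.mem_range.2 h) h0
  | succ l ih =>
    have := ih (by omega) (N + 2) (q + 1)
    rw [show N + 2 * (l + 1) = N + 2 + 2 * l by ring,
      show q + ((l + 1 : ℕ) : ℤ) = q + 1 + l by push_cast; ring, this]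
    have h' := sum_oddCoeff_succ h (fun k => oddChoose N q k) (by simp [oddChoose])
    push_cast at h'
    rw [← h']
    exact Finset.sum_congr rfl fun k _ => by rw [oddChoose_add_two]

/-- A difference of two adjacent binomial coefficients. -/
def ballotEntry (t y i l : ℕ) : ℤ :=
  intChoose (2 * y + t + 1 + i + 2 * l) (y - i + l) -
    intChoose (2 * y + t + 1 + i + 2 * l) (y - i + l - 1)

theorem ballotEntry_eq_oddChoose (t y i l : ℕ) :
    ballotEntry t y i l = oddChoose (2 * y + t + i + 2 * l) (y - i - 1 + l) 1 := by
  unfold ballotEntry oddChoose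
  rw [show 2 * y + t + 1 + i + 2 * l = 2 * y + t + i + 2 * l + 1 by ring, intChoose_succ,
    intChoose_succ]
  ring_nf

/-- The coefficients in `oddChoose_one_eq_sum` do not depend on the row, so they form an upper
unitriangular right factor. -/
theorem det_oddChoose_eq_det_ballotEntry (n t y : ℕ) :
    (Matrix.of fun i l : Fin n =>
      oddChoose (2 * y + t + i) ((y : ℤ) - (i : ℕ) - 1) (((l : ℕ) : ℤ) + 1)).det =
    (Matrix.of fun i l : Fin n => ballotEntry t y i l).det := by
  have hmul : (Matrix.of fun i l : Fin n => ballotEntry t y i l) =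
      (Matrix.of fun i l : Fin n =>
        oddChoose (2 * y + t + i) ((y : ℤ) - (i : ℕ) - 1) (((l : ℕ) : ℤ) + 1)) *
      Matrix.of fun k l : Fin n => oddCoeff l k := by
    ext i l
    rw [Matrix.mul_apply, Matrix.of_apply, ballotEntry_eq_oddChoose, oddChoose_one_eq_sum l.2,
      ← Fin.sum_univ_eq_sum_range fun k =>
        oddCoeff l k * oddChoose (2 * y + t + i) ((y : ℤ) - (i : ℕ) - 1) ((k : ℤ) + 1)]
    exact Finset.sum_congr rfl fun k _ => mul_comm _ _
  have htri : (Matrix.of fun k l : Fin n => oddCoeff l k).BlockTriangular id :=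
    fun k l hkl => oddCoeff_eq_zero hkl
  rw [hmul, Matrix.det_mul, Matrix.det_of_isUpperTriangular htri]
  simp [oddCoeff_self]

/-- At `t = b + c` the two lower indices are symmetric about `c + m - a`, at distance `a - k`.
Reversing both index orders turns this distance into `l + 1`. -/
theorem det_pathCount_eq_det_ballotEntry {a b c : ℕ} (h : (b : ℤ) ≥ (a : ℤ) + (c : ℤ) - 1) :
    (Matrix.of fun m k : Fin a => pathCount a b c (b + c) m (k : ℕ)).det =
      (Matrix.of fun i l : Fin a => ballotEntry (b + 1 - a - c) c i l).det := by
  rw [← det_oddChoose_eq_det_ballotEntry, ← Matrix.det_submatrix_equiv_self Fin.revPerm]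
  congr 1
  ext i l
  have hi := i.2
  have hl := l.2
  simp only [Matrix.submatrix_apply, Matrix.of_apply, Fin.revPerm_apply, Fin.val_rev, pathCount,
    oddChoose]
  congr 2 <;> omega

/-! ### The Desnanot–Jacobi identity -/

section Condensation

open Matrix

variable {K : Type*} [Field K] {n : ℕ}

/-- The two reindexings differ from a simultaneous one by inverse permutations, whose signs cancel.
-/
theorem det_submatrix_mul_det_submatrix_swap {m m' R : Type*} [Fintype m] [DecidableEq m]
    [Fintype m'] [DecidableEq m'] [CommRing R] (e₁ e₂ : m ≃ m') (M N : Matrix m' m' R) :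
    (M.submatrix e₁ e₂).det * (N.submatrix e₂ e₁).det = M.det * N.det := by
  let σ : Equiv.Perm m' := e₂.symm.trans e₁
  have h₁ : M.submatrix e₁ e₂ = (M.submatrix σ id).submatrix e₂ e₂ := by
    ext i j
    simp [σ]
  have h₂ : N.submatrix e₂ e₁ = (N.submatrix σ.symm id).submatrix e₁ e₁ := by
    ext i j
    simp [σ]
  rw [h₁, h₂, det_submatrix_equiv_self, det_submatrix_equiv_self, det_permute, det_permute,
    Equiv.Perm.sign_symm, mul_mul_mul_comm, ← Int.cast_mul, ← Units.val_mul, Int.units_mul_self]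
  simp

/-- Dodgson condensation (the Desnanot–Jacobi identity), for an invertible inner minor. -/
theorem det_mul_det_inner (M : Matrix (Fin (n + 2)) (Fin (n + 2)) K)
    (h : (M.submatrix (fun i : Fin n => i.castSucc.succ) fun i : Fin n => i.castSucc.succ).det ≠ 0) :
    M.det * (M.submatrix (fun i : Fin n => i.castSucc.succ) fun i : Fin n => i.castSucc.succ).det =
      (M.submatrix Fin.castSucc Fin.castSucc).det * (M.submatrix Fin.succ Fin.succ).det -
      (M.submatrix Fin.succ Fin.castSucc).det * (M.submatrix Fin.castSucc Fin.succ).det := by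
  set ι : Fin n → Fin (n + 2) := fun i => i.castSucc.succ with hι
  let pt : Fin 2 → Fin (n + 2) := ![0, Fin.last (n + 1)]
  let e : Fin n ⊕ Fin 2 ≃ Fin (n + 2) := Equiv.ofBijective (Sum.elim ι pt) <| by
    refine (Fintype.bijective_iff_injective_and_card _).2 ⟨?_, by simp⟩
    rintro (i | i) (j | j) hij
    · simpa [ι] using hij
    · exfalso
      fin_cases j <;> simp [ι, pt, Fin.ext_iff] at hij
      omega
    · exfalso
      fin_cases i <;> simp [ι, pt, Fin.ext_iff] at hij
      omega
    · fin_cases i <;> fin_cases j <;> simp [pt, Fin.ext_iff] at hij ⊢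
  let e₁ : Fin n ⊕ Unit ≃ Fin (n + 1) := Equiv.ofBijective (Sum.elim Fin.succ fun _ => 0) <| by
    refine (Fintype.bijective_iff_injective_and_card _).2 ⟨?_, by simp⟩
    rintro (i | i) (j | j) hij <;> simp [Fin.ext_iff] at hij ⊢
    omega
  let e₂ : Fin n ⊕ Unit ≃ Fin (n + 1) :=
    Equiv.ofBijective (Sum.elim Fin.castSucc fun _ => Fin.last n) <| by
    refine (Fintype.bijective_iff_injective_and_card _).2 ⟨?_, by simp⟩
    rintro (i | i) (j | j) hij <;> simp [Fin.ext_iff] at hij ⊢ <;> omega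
  set A := M.submatrix ι ι with hA
  have : Invertible A.det := invertibleOfNonzero h
  let : Invertible A := invertibleOfDetInvertible A
  -- The Schur complement of the inner block. Each minor of size `n + 1` is `A.det` times an entry
  -- of `S`, up to a sign that cancels in the mixed product, so the identity reduces to the `2 × 2`
  -- determinant of `S`.
  let S : Matrix (Fin 2) (Fin 2) K := M.submatrix pt pt - M.submatrix pt ι * ⅟A * M.submatrix ι pt
  have hM : M.det = A.det * S.det := by
    rw [← det_submatrix_equiv_self e M, ← det_fromBlocks₁₁]
    congr 1
    ext (i | i) (j | j) <;> rfl
  let φ : Fin 2 → Fin n ⊕ Unit → Fin (n + 2) := fun p => Sum.elim ι fun _ => pt p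
  have hborder : ∀ p q, (M.submatrix (φ p) (φ q)).det = A.det * S p q := by
    intro p q
    have : M.submatrix (φ p) (φ q) = fromBlocks A (M.submatrix ι fun _ => pt q)
        (M.submatrix (fun _ => pt p) ι) (M.submatrix (fun _ => pt p) fun _ => pt q) := by
      ext (i | i) (j | j) <;> rfl
    rw [this, det_fromBlocks₁₁, det_unique (n := Unit)]
    rfl
  have hφ₀ : φ 0 = Fin.castSucc ∘ e₁ := by
    ext (i | i)
    · simp [φ, e₁, ι]
    · simp [φ, e₁, pt]
  have hφ₁ : φ 1 = Fin.succ ∘ e₂ := by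
    ext (i | i)
    · simp [φ, e₂, ι]
    · simp [φ, e₂, pt]
  have h00 := hborder 0 0
  have h01 := hborder 0 1
  have h10 := hborder 1 0
  have h11 := hborder 1 1
  rw [hφ₀, ← submatrix_submatrix, det_submatrix_equiv_self] at h00
  rw [hφ₁, ← submatrix_submatrix, det_submatrix_equiv_self] at h11
  rw [hφ₀, hφ₁, ← submatrix_submatrix] at h01 h10
  have hswap := det_submatrix_mul_det_submatrix_swap e₂ e₁ (M.submatrix Fin.succ Fin.castSucc)
    (M.submatrix Fin.castSucc Fin.succ)
  rw [h01, h10] at hswap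
  rw [h00, h11, ← hswap, hM, det_fin_two]
  ring

end Condensation
-- The product formula and its recurrence
/-- The product `∏ (s + 2 j)!` over `j < n`. -/
def evenFactorialProd (n s : ℕ) : ℕ := ∏ j ∈ Finset.range n, (s + 2 * j).factorial

/-- The product `∏ (y + j)!` over `j < n`. -/
def factorialProd (n y : ℕ) : ℕ := ∏ j ∈ Finset.range n, (y + j).factorial

/-- The product `∏ (t + 2 j + 2)_{j + 1}` over `j < n`. -/
def growingAscProd (n t : ℕ) : ℕ :=
  ∏ j ∈ Finset.range n, (t + 2 * j + 2).ascFactorial (j + 1)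

/-- The product `∏ (u + 3 j + 3)_{n - 1 - j}` over `j < n`. -/
def shrinkingAscProd (n u : ℕ) : ℕ :=
  ∏ j ∈ Finset.range n, (u + 3 * j + 3).ascFactorial (n - 1 - j)

theorem evenFactorialProd_pos (n s : ℕ) : 0 < evenFactorialProd n s :=
  Finset.prod_pos fun _ _ => Nat.factorial_pos _

theorem factorialProd_pos (n y : ℕ) : 0 < factorialProd n y :=
  Finset.prod_pos fun _ _ => Nat.factorial_pos _

theorem growingAscProd_pos (n t : ℕ) : 0 < growingAscProd n t :=
  Finset.prod_pos fun _ _ => Nat.ascFactorial_pos _ _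

theorem shrinkingAscProd_pos (n u : ℕ) : 0 < shrinkingAscProd n u :=
  Finset.prod_pos fun _ _ => Nat.ascFactorial_pos _ _

theorem evenFactorialProd_succ (n s : ℕ) :
    evenFactorialProd (n + 1) s = evenFactorialProd n s * (s + 2 * n).factorial :=
  Finset.prod_range_succ _ _

theorem evenFactorialProd_succ' (n s : ℕ) :
    evenFactorialProd (n + 1) s = s.factorial * evenFactorialProd n (s + 2) := by
  rw [evenFactorialProd, Finset.prod_range_succ', mul_comm]
  congr 1
  exact Finset.prod_congr rfl fun j _ => by congr 1; ring

theorem factorialProd_succ (n y : ℕ) :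
    factorialProd (n + 1) y = factorialProd n y * (y + n).factorial :=
  Finset.prod_range_succ _ _

theorem factorialProd_succ' (n y : ℕ) :
    factorialProd (n + 1) y = y.factorial * factorialProd n (y + 1) := by
  rw [factorialProd, Finset.prod_range_succ', mul_comm]
  congr 1
  exact Finset.prod_congr rfl fun j _ => by congr 1; ring

theorem growingAscProd_succ (n t : ℕ) :
    growingAscProd (n + 1) t = growingAscProd n t * (t + 2 * n + 2).ascFactorial (n + 1) :=
  Finset.prod_range_succ _ _

theorem shrinkingAscProd_succ' (n u : ℕ) :
    shrinkingAscProd (n + 1) u = (u + 3).ascFactorial n * shrinkingAscProd n (u + 3) := by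
  rw [shrinkingAscProd, Finset.prod_range_succ', mul_comm]
  congr 1
  exact Finset.prod_congr rfl fun j _ => by congr 1 <;> omega

theorem ascFactorial_succ_eq_mul (n k : ℕ) :
    n.ascFactorial (k + 1) = n * (n + 1).ascFactorial k := by
  induction k with
  | zero => simp [Nat.ascFactorial_succ]
  | succ k ih =>
    rw [Nat.ascFactorial_succ, ih, Nat.ascFactorial_succ]
    ring

/-- This and the following identities compare the products in the three terms of the condensation;
after cancellation a single linear factor remains. -/
theorem evenFactorialProd_mul_right (n s : ℕ) :
    evenFactorialProd (n + 1) s * evenFactorialProd (n + 1) (s + 3) =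
      (s + 2 * n + 3) * (evenFactorialProd (n + 2) s * evenFactorialProd n (s + 3)) := by
  rw [evenFactorialProd_succ (n + 1), evenFactorialProd_succ n (s + 3),
    show s + 3 + 2 * n = s + 2 * (n + 1) + 1 by ring, Nat.factorial_succ]
  ring

theorem evenFactorialProd_mul_left (n s : ℕ) :
    evenFactorialProd (n + 1) (s + 1) * evenFactorialProd (n + 1) (s + 2) =
      (s + 1) * (evenFactorialProd (n + 2) s * evenFactorialProd n (s + 3)) := by
  rw [evenFactorialProd_succ' (n + 1), evenFactorialProd_succ' n (s + 1), Nat.factorial_succ]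
  ring

theorem mul_evenFactorialProd_right (n p : ℕ) :
    (p + 2 * n + 2) * (evenFactorialProd (n + 1) p * evenFactorialProd (n + 1) (p + 1)) =
      evenFactorialProd (n + 2) p * evenFactorialProd n (p + 1) := by
  rw [evenFactorialProd_succ (n + 1), evenFactorialProd_succ n (p + 1),
    show p + 2 * (n + 1) = p + 1 + 2 * n + 1 by ring, Nat.factorial_succ]
  ring

theorem mul_evenFactorialProd_left (n e : ℕ) :
    (e + 1) * (evenFactorialProd (n + 1) e * evenFactorialProd (n + 1) (e + 3)) =
      evenFactorialProd (n + 2) (e + 1) * evenFactorialProd n (e + 2) := by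
  rw [evenFactorialProd_succ' (n + 1), evenFactorialProd_succ' n e, Nat.factorial_succ]
  ring

theorem mul_factorialProd_right (n y : ℕ) :
    (y + n + 1) * (factorialProd (n + 1) y * factorialProd (n + 1) y) =
      factorialProd (n + 2) y * factorialProd n y := by
  rw [factorialProd_succ (n + 1), factorialProd_succ n, ← add_assoc, Nat.factorial_succ]
  ring

theorem mul_factorialProd_left (n y : ℕ) :
    (y + 1) * (factorialProd (n + 1) y * factorialProd (n + 1) (y + 2)) =
      factorialProd (n + 2) (y + 1) * factorialProd n (y + 1) := by
  rw [factorialProd_succ' (n + 1), factorialProd_succ' n y, Nat.factorial_succ]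
  ring

theorem mul_growingAscProd (n t : ℕ) :
    (t + 2 * n + 4) * (growingAscProd (n + 1) t * growingAscProd (n + 1) (t + 3)) =
      growingAscProd (n + 2) t * growingAscProd n (t + 3) := by
  rw [growingAscProd_succ (n + 1), growingAscProd_succ n (t + 3), ascFactorial_succ_eq_mul _ (n + 1),
    show t + 3 + 2 * n + 2 = t + 2 * (n + 1) + 2 + 1 by ring]
  ring

theorem mul_shrinkingAscProd (n u : ℕ) :
    (u + n + 3) * (shrinkingAscProd (n + 1) u * shrinkingAscProd (n + 1) (u + 3)) =
      shrinkingAscProd (n + 2) u * shrinkingAscProd n (u + 3) := by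
  rw [shrinkingAscProd_succ' (n + 1) u, shrinkingAscProd_succ' n u, Nat.ascFactorial_succ]
  ring

/-- The product formula for the determinant of `ballotEntry`. -/
def ballotProd (n t y : ℕ) : ℚ :=
  (factorialProd n 0 * evenFactorialProd n (2 * y + t + 1) * growingAscProd n t *
      shrinkingAscProd n (3 * y + t)) /
    (evenFactorialProd n (y + t + n + 1) * factorialProd n y)

/-- Guarantees that the inner minors in the condensation do not vanish. -/
theorem ballotProd_pos (n t y : ℕ) : 0 < ballotProd n t y := by
  have h1 : ∀ n s, (0 : ℚ) < evenFactorialProd n s := fun n s => mod_cast evenFactorialProd_pos n s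
  have h2 : ∀ n s, (0 : ℚ) < factorialProd n s := fun n s => mod_cast factorialProd_pos n s
  have h3 : ∀ n s, (0 : ℚ) < growingAscProd n s := fun n s => mod_cast growingAscProd_pos n s
  have h4 : ∀ n s, (0 : ℚ) < shrinkingAscProd n s := fun n s => mod_cast shrinkingAscProd_pos n s
  exact div_pos (mul_pos (mul_pos (mul_pos (h2 _ _) (h1 _ _)) (h3 _ _)) (h4 _ _))
    (mul_pos (h1 _ _) (h2 _ _))

theorem factorial_mul_ascFactorial_eq {m m' k l : ℕ} (h : m' = m + 1) (h' : l = m + k) :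
    m.factorial * m'.ascFactorial k = l.factorial := by
  rw [h, h', Nat.factorial_mul_ascFactorial]

/-- For each `j` the factorial and the two rising factorials are consecutive and merge into `(t + n
+ 1 + 2 j)!`. -/
theorem ballotProd_zero_right (n t : ℕ) : ballotProd n t 0 = 1 := by
  have key : evenFactorialProd n (2 * 0 + t + 1) * growingAscProd n t *
      shrinkingAscProd n (3 * 0 + t) = evenFactorialProd n (0 + t + n + 1) := by
    unfold evenFactorialProd growingAscProd shrinkingAscProd
    rw [← Finset.prod_mul_distrib, ← Finset.prod_mul_distrib]
    refine Finset.prod_congr rfl fun j hj => ?_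
    have := Finset.mem_range.1 hj
    rw [factorial_mul_ascFactorial_eq (m' := t + 2 * j + 2) (l := t + 3 * j + 2) (by omega)
      (by omega), factorial_mul_ascFactorial_eq (l := 0 + t + n + 1 + 2 * j) (by omega) (by omega)]
  have h1 : (evenFactorialProd n (0 + t + n + 1) : ℚ) ≠ 0 :=
    mod_cast (evenFactorialProd_pos _ _).ne'
  have h2 : (factorialProd n 0 : ℚ) ≠ 0 := mod_cast (factorialProd_pos _ _).ne'
  rw [ballotProd, mul_assoc, mul_assoc, ← mul_assoc (evenFactorialProd n _ : ℚ)]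
  rw [← Nat.cast_mul (evenFactorialProd n _), ← Nat.cast_mul _ (shrinkingAscProd n _), key,
    mul_comm (factorialProd n 0 : ℚ), div_self (mul_ne_zero h1 h2)]

theorem ballotProd_zero (t y : ℕ) : ballotProd 0 t y = 1 := by
  simp [ballotProd, evenFactorialProd, factorialProd, growingAscProd, shrinkingAscProd]

/-- Brings a product of two values to a common form with scalar `d`; used for all three terms of the
condensation. -/
theorem ballotProd_mul_ballotProd {n n' t t' y y' : ℕ} {r d f g v p q : ℚ} {F G V A B C : ℕ}
    (hA : (factorialProd n 0 * factorialProd n' 0 : ℚ) = r * A)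
    (hF : (evenFactorialProd n (2 * y + t + 1) * evenFactorialProd n' (2 * y' + t' + 1) : ℚ) =
      f * F)
    (hB : (growingAscProd n t * growingAscProd n' t' : ℚ) = p * B)
    (hC : (shrinkingAscProd n (3 * y + t) * shrinkingAscProd n' (3 * y' + t') : ℚ) = q * C)
    (hG : g * (evenFactorialProd n (y + t + n + 1) * evenFactorialProd n' (y' + t' + n' + 1) : ℚ) =
      G)
    (hV : v * (factorialProd n y * factorialProd n' y' : ℚ) = V)
    (hG0 : (G : ℚ) ≠ 0) (hV0 : (V : ℚ) ≠ 0) (hd : d = r * f * p * q * g * v) :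
    ballotProd n t y * ballotProd n' t' y' = d * (A * F * B * C / (G * V)) := by
  rw [← hG, mul_ne_zero_iff, mul_ne_zero_iff] at hG0
  rw [← hV, mul_ne_zero_iff, mul_ne_zero_iff] at hV0
  obtain ⟨hg, hg1, hg2⟩ := hG0
  obtain ⟨hv, hv1, hv2⟩ := hV0
  have key : ballotProd n t y * ballotProd n' t' y' =
      (factorialProd n 0 * factorialProd n' 0 : ℚ) *
        (evenFactorialProd n (2 * y + t + 1) * evenFactorialProd n' (2 * y' + t' + 1) : ℚ) *
        (growingAscProd n t * growingAscProd n' t' : ℚ) *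
        (shrinkingAscProd n (3 * y + t) * shrinkingAscProd n' (3 * y' + t') : ℚ) /
      ((evenFactorialProd n (y + t + n + 1) * evenFactorialProd n' (y' + t' + n' + 1) : ℚ) *
        (factorialProd n y * factorialProd n' y' : ℚ)) := by
    unfold ballotProd
    rw [div_mul_div_comm]
    congr 1 <;> ring
  rw [key, hA, hF, hB, hC, ← hG, ← hV, hd]
  field_simp

theorem ballotProd_condensation (n t y : ℕ) :
    ballotProd (n + 2) t (y + 1) * ballotProd n (t + 3) (y + 1) =
      ballotProd (n + 1) t (y + 1) * ballotProd (n + 1) (t + 3) (y + 1) -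
      ballotProd (n + 1) (t + 3) y * ballotProd (n + 1) t (y + 2) := by
  let A := factorialProd (n + 1) 0 * factorialProd (n + 1) 0
  let F := evenFactorialProd (n + 2) (2 * y + t + 3) * evenFactorialProd n (2 * y + t + 6)
  let B := growingAscProd (n + 1) t * growingAscProd (n + 1) (t + 3)
  let C := shrinkingAscProd (n + 1) (3 * y + 3 + t) * shrinkingAscProd (n + 1) (3 * y + 6 + t)
  let G := evenFactorialProd (n + 2) (y + t + n + 4) * evenFactorialProd n (y + t + n + 5)
  let V := factorialProd (n + 2) (y + 1) * factorialProd n (y + 1)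
  have hG0 : (G : ℚ) ≠ 0 := by
    have := evenFactorialProd_pos
    exact_mod_cast (Nat.mul_pos (this _ _) (this _ _)).ne'
  have hV0 : (V : ℚ) ≠ 0 := by
    have := factorialProd_pos
    exact_mod_cast (Nat.mul_pos (this _ _) (this _ _)).ne'
  have hA : (n + 1) * A = factorialProd (n + 2) 0 * factorialProd n 0 := by
    simpa using mul_factorialProd_right n 0
  have hs1 : evenFactorialProd (n + 1) (2 * y + t + 3) * evenFactorialProd (n + 1) (2 * y + t + 6) =
    (2 * y + t + 2 * n + 6) * F := by
    rw [evenFactorialProd_mul_right n (2 * y + t + 3)]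
    simp only [F]
    ring
  have hs2 : evenFactorialProd (n + 1) (2 * y + t + 4) * evenFactorialProd (n + 1) (2 * y + t + 5) =
    (2 * y + t + 4) * F := evenFactorialProd_mul_left n (2 * y + t + 3)
  have hp1 : (y + t + 3 * n + 6) * (evenFactorialProd (n + 1) (y + t + n + 4) *
      evenFactorialProd (n + 1) (y + t + n + 5)) = G := by
    simp only [G]
    rw [← mul_evenFactorialProd_right n (y + t + n + 4)]
    ring
  have hp2 : (y + t + n + 4) * (evenFactorialProd (n + 1) (y + t + n + 3) *
      evenFactorialProd (n + 1) (y + t + n + 6)) = G :=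
    mul_evenFactorialProd_left n (y + t + n + 3)
  have hv1 : (y + n + 2) * (factorialProd (n + 1) (y + 1) * factorialProd (n + 1) (y + 1)) = V := by
    simp only [V]
    rw [← mul_factorialProd_right n (y + 1)]
    ring
  have hv2 : (y + 1) * (factorialProd (n + 1) y * factorialProd (n + 1) (y + 2)) = V :=
    mul_factorialProd_left n y
  have ht : (t + 2 * n + 4) * B = growingAscProd (n + 2) t * growingAscProd n (t + 3) :=
    mul_growingAscProd n t
  have hu : (3 * y + t + n + 6) * C =
      shrinkingAscProd (n + 2) (3 * y + 3 + t) * shrinkingAscProd n (3 * y + 6 + t) := by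
    rw [show 3 * y + 6 + t = 3 * y + 3 + t + 3 by ring, ← mul_shrinkingAscProd]
    simp only [C, show 3 * y + 6 + t = 3 * y + 3 + t + 3 by ring]
    ring
  rw [ballotProd_mul_ballotProd (A := A) (F := F) (B := B) (C := C) (G := G) (V := V)
      (r := n + 1) (f := 1) (p := t + 2 * n + 4) (q := 3 * y + t + n + 6) (g := 1) (v := 1)
      (by exact_mod_cast hA.symm) _ _ _ _ _ hG0 hV0 rfl,
    ballotProd_mul_ballotProd (A := A) (F := F) (B := B) (C := C) (G := G) (V := V)
      (n := n + 1) (n' := n + 1) (t := t) (t' := t + 3) (y := y + 1) (y' := y + 1)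
      (r := 1) (f := 2 * y + t + 2 * n + 6) (p := 1) (q := 1) (g := y + t + n + 4)
      (v := y + n + 2) _ _ _ _ _ _ hG0 hV0 rfl,
    ballotProd_mul_ballotProd (A := A) (F := F) (B := B) (C := C) (G := G) (V := V)
      (n := n + 1) (n' := n + 1) (t := t + 3) (t' := t) (y := y) (y' := y + 2)
      (r := 1) (f := 2 * y + t + 4) (p := 1) (q := 1) (g := y + t + 3 * n + 6)
      (v := y + 1) _ _ _ _ _ _ hG0 hV0 rfl, ← sub_mul]
  -- After removal of the common factor, this is the polynomial identity `(n+1)(t+2n+4)(3y+t+n+6) =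
  -- (2y+t+2n+6)(y+t+n+4)(y+n+2) - (2y+t+4)(y+t+3n+6)(y+1)`.
  · congr 1
    ring
  all_goals first
    | (simp only [A, F, B, C, G, V]; push_cast; ring_nf; done)
    | (qify at hs1; ring_nf at hs1 ⊢; linear_combination hs1)
    | (qify at hs2; ring_nf at hs2 ⊢; linear_combination hs2)
    | (qify at hp1; ring_nf at hp1 ⊢; linear_combination hp1)
    | (qify at hp2; ring_nf at hp2 ⊢; linear_combination hp2)
    | (qify at hv1; ring_nf at hv1 ⊢; linear_combination hv1)
    | (qify at hv2; ring_nf at hv2 ⊢; linear_combination hv2)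
    | (qify at ht; ring_nf at ht ⊢; linear_combination -ht)
    | (qify at hu; ring_nf at hu ⊢; linear_combination -hu)
-- Evaluation of the ballot determinant
theorem ballotEntry_succ_succ (t y i l : ℕ) :
    ballotEntry t y (i + 1) (l + 1) = ballotEntry (t + 3) y i l := by
  unfold ballotEntry
  rw [show 2 * y + t + 1 + (i + 1) + 2 * (l + 1) = 2 * y + (t + 3) + 1 + i + 2 * l by ring]
  push_cast
  ring_nf

theorem ballotEntry_succ_left (t y i l : ℕ) :
    ballotEntry t (y + 1) (i + 1) l = ballotEntry (t + 3) y i l := by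
  unfold ballotEntry
  rw [show 2 * (y + 1) + t + 1 + (i + 1) + 2 * l = 2 * y + (t + 3) + 1 + i + 2 * l by ring]
  push_cast
  ring_nf

theorem ballotEntry_succ_right (t y i l : ℕ) :
    ballotEntry t y i (l + 1) = ballotEntry t (y + 1) i l := by
  unfold ballotEntry
  rw [show 2 * y + t + 1 + i + 2 * (l + 1) = 2 * (y + 1) + t + 1 + i + 2 * l by ring]
  push_cast
  ring_nf

/-- The matrix of ballot numbers over the rationals. -/
def ballotMatrix (n t y : ℕ) : Matrix (Fin n) (Fin n) ℚ :=
  Matrix.of fun i l => (ballotEntry t y i l : ℚ)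

/-- At `y = 0` the lower indices are negative below the diagonal, and the diagonal entries are `1`.
-/
theorem det_ballotMatrix_zero_right (n t : ℕ) : (ballotMatrix n t 0).det = 1 := by
  have htri : (ballotMatrix n t 0).IsUpperTriangular := by
    intro i l hil
    have : (l : ℕ) < i := hil
    rw [ballotMatrix, Matrix.of_apply, ballotEntry, intChoose_of_neg _ (by push_cast; omega),
      intChoose_of_neg _ (by push_cast; omega)]
    simp
  rw [Matrix.det_of_isUpperTriangular htri]
  refine Finset.prod_eq_one fun i _ => ?_
  rw [ballotMatrix, Matrix.of_apply, ballotEntry, intChoose_of_neg _ (k := _ - 1)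
    (by push_cast; omega), show ((0 : ℕ) : ℤ) - (i : ℕ) + (i : ℕ) = (0 : ℕ) by push_cast; ring,
    intChoose_natCast]
  simp

theorem det_ballotMatrix_condensation (n t y : ℕ) (h : (ballotMatrix n (t + 3) (y + 1)).det ≠ 0) :
    (ballotMatrix (n + 2) t (y + 1)).det * (ballotMatrix n (t + 3) (y + 1)).det =
      (ballotMatrix (n + 1) t (y + 1)).det * (ballotMatrix (n + 1) (t + 3) (y + 1)).det -
      (ballotMatrix (n + 1) (t + 3) y).det * (ballotMatrix (n + 1) t (y + 2)).det := by
  have h₁ : (ballotMatrix (n + 2) t (y + 1)).submatrix (fun i : Fin n => i.castSucc.succ)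
      (fun i : Fin n => i.castSucc.succ) = ballotMatrix n (t + 3) (y + 1) := by
    ext i l
    simp [ballotMatrix, ballotEntry_succ_succ]
  have h₂ : (ballotMatrix (n + 2) t (y + 1)).submatrix Fin.castSucc Fin.castSucc =
      ballotMatrix (n + 1) t (y + 1) := by
    ext i l
    simp [ballotMatrix]
  have h₃ : (ballotMatrix (n + 2) t (y + 1)).submatrix Fin.succ Fin.succ =
      ballotMatrix (n + 1) (t + 3) (y + 1) := by
    ext i l
    simp [ballotMatrix, ballotEntry_succ_succ]
  have h₄ : (ballotMatrix (n + 2) t (y + 1)).submatrix Fin.succ Fin.castSucc =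
      ballotMatrix (n + 1) (t + 3) y := by
    ext i l
    simp [ballotMatrix, ballotEntry_succ_left]
  have h₅ : (ballotMatrix (n + 2) t (y + 1)).submatrix Fin.castSucc Fin.succ =
      ballotMatrix (n + 1) t (y + 2) := by
    ext i l
    simp [ballotMatrix, ballotEntry_succ_right]
  have := det_mul_det_inner (ballotMatrix (n + 2) t (y + 1)) (by rwa [h₁])
  rwa [h₁, h₂, h₃, h₄, h₅] at this

theorem det_ballotMatrix_one (t y : ℕ) : (ballotMatrix 1 t y).det = ballotProd 1 t y := by
  cases y with
  | zero => rw [det_ballotMatrix_zero_right, ballotProd_zero_right]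
  | succ y =>
    have h₁ : ((2 * (y + 1) + t + 1).choose (y + 1) : ℚ) =
        (2 * y + t + 3).factorial / ((y + 1).factorial * (y + t + 2).factorial) := by
      rw [show 2 * (y + 1) + t + 1 = y + 1 + (y + t + 2) by ring, Nat.cast_add_choose,
        show y + 1 + (y + t + 2) = 2 * y + t + 3 by ring]
    have h₂ : ((2 * (y + 1) + t + 1).choose y : ℚ) =
        (2 * y + t + 3).factorial / (y.factorial * (y + t + 3).factorial) := by
      rw [show 2 * (y + 1) + t + 1 = y + (y + t + 3) by ring, Nat.cast_add_choose,
        show y + (y + t + 3) = 2 * y + t + 3 by ring]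
    rw [Matrix.det_fin_one, ballotMatrix, Matrix.of_apply, ballotEntry,
      show ((y + 1 : ℕ) : ℤ) - ((0 : Fin 1) : ℕ) + ((0 : Fin 1) : ℕ) = ((y + 1 : ℕ) : ℤ) by simp,
      show ((y + 1 : ℕ) : ℤ) - 1 = (y : ℤ) by simp, intChoose_natCast, intChoose_natCast]
    simp only [ballotProd, factorialProd, evenFactorialProd, growingAscProd, shrinkingAscProd,
      Finset.prod_range_one, Fin.val_zero, add_zero, mul_zero, Int.cast_sub, Int.cast_natCast,
      h₁, h₂]
    rw [show y + 1 + t + 1 + 1 = y + t + 2 + 1 by ring,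
      show 2 * (y + 1) + t + 1 = 2 * y + t + 3 by ring, Nat.factorial_succ (y + t + 2),
      Nat.factorial_succ y]
    have hy : (y.factorial : ℚ) ≠ 0 := mod_cast y.factorial_ne_zero
    have hyt : ((y + t + 2).factorial : ℚ) ≠ 0 := mod_cast (y + t + 2).factorial_ne_zero
    simp [Nat.ascFactorial_succ]
    field_simp
    ring

/-- Condensation expresses size `n + 2` through smaller sizes with shifted `t, y`, so the induction
is on size alone; `y = 0`, where `y - 1` is unavailable, is the unitriangular case. -/
theorem det_ballotMatrix (n : ℕ) : ∀ t y, (ballotMatrix n t y).det = ballotProd n t y := by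
  induction n using Nat.twoStepInduction with
  | zero => intro t y; rw [Matrix.det_fin_zero, ballotProd_zero]
  | one => exact det_ballotMatrix_one
  | more n ih₁ ih₂ =>
    intro t y
    cases y with
    | zero => rw [det_ballotMatrix_zero_right, ballotProd_zero_right]
    | succ y =>
      have hne := (ballotProd_pos n (t + 3) (y + 1)).ne'
      have h := det_ballotMatrix_condensation n t y (by rwa [ih₁])
      rw [ih₁, ih₂, ih₂, ih₂, ih₂, ← ballotProd_condensation] at h
      exact mul_right_cancel₀ hne h

/-! ### Comparison with `P` and conclusion -/

theorem shiftedFactorial_natCast (m k : ℕ) : shiftedFactorial m k = m.ascFactorial k := by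
  rw [shiftedFactorial, Nat.cast_ascFactorial]

theorem productP_eq_ballotProd {a b c : ℕ} (h : (b : ℤ) ≥ (a : ℤ) + (c : ℤ) - 1) :
    productP a ((b : ℤ) - (a : ℤ)) (c : ℤ) = ballotProd a (b + 1 - a - c) c := by
  obtain ⟨t, ht⟩ : ∃ t, b + 1 = a + c + t := ⟨b + 1 - a - c, by omega⟩
  have hb : (b : ℤ) = a + c + t - 1 := by omega
  -- In `P` the factors `(y + n - j)!` run downwards, so this product is reversed before comparing
  -- factor by factor.
  have hV : factorialProd a c = ∏ j ∈ Finset.range a, (c + (a - 1 - j)).factorial :=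
    (Finset.prod_range_reflect (fun j => (c + j).factorial) a).symm
  rw [show b + 1 - a - c = t by omega, ballotProd, hV, productP,
    ← Finset.Ico_add_one_right_eq_Icc, Finset.prod_Ico_eq_prod_range, factorialProd,
    evenFactorialProd, evenFactorialProd, growingAscProd, shrinkingAscProd]
  push_cast
  simp only [← Finset.prod_mul_distrib, ← Finset.prod_div_distrib]
  refine Finset.prod_congr rfl fun j hj => ?_
  have hj' := Finset.mem_range.1 hj
  have hbq : (b : ℚ) = a + c + t - 1 := by exact_mod_cast congrArg (Int.cast (R := ℚ)) hb
  rw [show (b : ℚ) - a - c + 2 * (1 + j) + 1 = (t + 2 * j + 2 : ℕ) by rw [hbq]; push_cast; ring,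
    show (b : ℚ) - a + 2 * c + 3 * (1 + j) + 1 = (3 * c + t + 3 * j + 3 : ℕ) by
      rw [hbq]; push_cast; ring, shiftedFactorial_natCast, shiftedFactorial_natCast]
  rw [show 1 + j - 1 = 0 + j by omega, show a - (1 + j) = a - 1 - j by omega, add_comm 1 j,
    show ((b : ℤ) - a + c + 2 * (1 + j)).toNat = 2 * c + t + 1 + 2 * j by omega,
    show ((b : ℤ) - a + a + 2 * (1 + j)).toNat = c + t + a + 1 + 2 * j by omega,
    show ((c : ℤ) + a - (1 + j)).toNat = c + (a - 1 - j) by omega]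

theorem theorem1p6 (a b c : ℕ) (h : (b : ℤ) ≥ (a : ℤ) + (c : ℤ) - 1) :
    (numTilings (hexagonAdj a b c) : ℚ) = productP a ((b : ℤ) - (a : ℤ)) (c : ℤ) := by
  rw [productP_eq_ballotProd h, ← det_ballotMatrix, ← Int.cast_natCast (R := ℚ),
    numTilings_hexagonAdj_eq_det h, det_pathCount_eq_det_ballotEntry h, Int.cast_det]
  rfl
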